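/- **Conventions.** The subspace generated by a set of points of a point-line geometry is the smallest subspace containing it, where a subspace is a set of points that contains all points of every line having at least two distinct points in it. For a geometry $\Delta$ with a diagram and a set $J$ of types, $\mathrm{Gr}_J(\Delta)$ is the point-line geometry whose points are the flags of type $J$ and whose lines are the flags of type $(J\setminus\{j\})\cup \mathrm{fr}(j)$, $j\in J$, where $\mathrm{fr}(j)$ is the set of types adjacent to $j$ in the diagram; a point and a line are incident when their union is a flag. For a division ring $\mathbb K$ and a right $\mathbb K$-vector space $V$ of dimension $n+1$, $A_n(\mathbb K)$ has as elements of type $i$ $(1\le i\le n)$ the $i$-dimensional subspaces of $V$, with symmetrized inclusion as incidence; its diagram is the path $1,2,\dots,n$. For a field $\mathbb K$, a $2n$-dimensional $\mathbb K$-vector space $V$ and a non-degenerate quadratic form $q$ on $V$ of Witt index $n$, the $n$-dimensional totally singular subspaces form two classes $\mathfrak S^+,\mathfrak S^-$ under the relation "$X\cap Y$ has even codimension in $X$" (the choice of which class is called $\mathfrak S^+$ is arbitrary). The elements of $D_n(\mathbb K)$ of type $i$ $(1\le i\le n-2)$ are the $i$-dimensional totally singular subspaces, those of types $+$ and $-$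 are the members of $\mathfrak S^+$ and $\mathfrak S^-$; $X\in\mathfrak S^+$ and $Y\in\mathfrak S^-$ are incident when $\dim(X\cap Y)=n-1$, and all other incidences are symmetrized inclusion. Its diagram has edges $\{i,i+1\}$ $(1\le i\le n-3)$, $\{n-2,+\}$, $\{n-2,-\}$. Let $E$ be a basis of $V$; in the case of $D_n$, $E=(e_1,\dots,e_{2n})$ is any basis with respect to which $q(x_1,\dots,x_{2n})=x_1x_2+x_3x_4+\dots+x_{2n-1}x_{2n}$. Given a sub-division ring $\mathbb K_0$ of $\mathbb K$, a subspace of $V$ is $\mathbb K_0$-rational if it has a basis consisting of linear combinations of $E$ with coefficients in $\mathbb K_0$; a flag is $\mathbb K_0$-rational if all its elements are. The $\mathbb K_0$-rational points and lines of $\Gamma(\mathbb K)=\mathrm{Gr}_J(X_n(\mathbb K))$, $X\in\{A,D\}$, form the subgeometry $\Gamma(\mathbb K_0)$. We say that $\Gamma(\mathbb K)$ is $\mathbb K_0$-generated if the points of $\Gamma(\mathbb K_0)$ generate $\Gamma(\mathbb K)$, that is, if no proper subspace of $\Gamma(\mathbb K)$ contains them all. **Theorem.** Let $\Gamma(\mathbb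 K)$ be one of the following: - $\mathrm{Gr}_{\{1,n\}}(A_n(\mathbb K))$, with $\mathbb K$ a division ring and $n\ge 3$; - $\mathrm{Gr}_{\{+,-\}}(D_n(\mathbb K))$, with $\mathbb K$ a field and $n\ge 3$; - $\mathrm{Gr}_{\{1,+,-\}}(D_n(\mathbb K))$, with $\mathbb K$ a field and $n\ge 4$; - $\mathrm{Gr}_{\{1,-\}}(D_n(\mathbb K))$, with $\mathbb K$ a field and $n\ge 4$. Then $\Gamma(\mathbb K)$ is not $\mathbb K_0$-generated, for any proper sub-division ring $\mathbb K_0$ of $\mathbb K$. -/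

import Mathlib

namespace JGrass

universe u v w

/-! ### Point-line geometries, subspaces and generation -/

/-- A point-line geometry: points, lines, and an incidence relation between them. -/
structure PointLineGeometry where
  Point : Type u
  Line : Type u
  Inc : Point → Line → Prop

/-- A set of points is a subspace if it contains every point of every line that has at least two
distinct points in it. -/
def PointLineGeometry.IsSubspace (G : PointLineGeometry.{u}) (S : Set G.Point) : Prop :=
  ∀ l : G.Line, ∀ p ∈ S, ∀ p' ∈ S, p ≠ p' → G.Inc p l → G.Inc p' l →
    ∀ x : G.Point, G.Inc x l → x ∈ S

/-- The subspace generated by a set of points: the intersection of all subspaces containing it. -/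
def PointLineGeometry.generatedSubspace (G : PointLineGeometry.{u}) (X : Set G.Point) :
    Set G.Point :=
  ⋂₀ {S | G.IsSubspace S ∧ X ⊆ S}

/-- A set of points generates the geometry if the subspace it generates is the whole point-set. -/
def PointLineGeometry.Generates (G : PointLineGeometry.{u}) (X : Set G.Point) : Prop :=
  G.generatedSubspace X = Set.univ

/-! ### Geometries over a diagram and their Grassmannians -/

/-- An incidence geometry with labels in `T`: typed elements, an incidence relation, and a diagram
graph on the labels. Labels that are not nodes of the diagram are isolated vertices of the graph
and are not the type of any element. -/
structure DiagramGeometry (T : Type w) where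
  Elem : Type u
  typ : Elem → T
  Inc : Elem → Elem → Prop
  diagram : SimpleGraph T

/-- A flag: a set of pairwise incident elements. -/
def DiagramGeometry.IsFlag {T : Type w} (D : DiagramGeometry.{u, w} T) (F : Set D.Elem) : Prop :=
  F.Pairwise D.Inc

/-- A flag of type `J`: a flag whose elements have precisely the types in `J`. (In the geometries
below, distinct elements of the same type are never incident, so that each type in `J` is the type
of exactly one element of the flag.) -/
def DiagramGeometry.IsFlagOfType {T : Type w} (D : DiagramGeometry.{u, w} T) (J : Set T)
    (F : Set D.Elem) : Prop :=
  D.IsFlag F ∧ D.typ '' F = J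

/-- `fr(j)`: the set of types adjacent to `j` in the diagram. -/
def DiagramGeometry.fr {T : Type w} (D : DiagramGeometry.{u, w} T) (j : T) : Set T :=
  {t | D.diagram.Adj j t}

/-- The `J`-Grassmannian as a point-line geometry: its points are the flags of type `J`, its lines
are the flags of type `(J \ {j}) ∪ fr(j)` for `j ∈ J`, and a point and a line are incident when
their union is a flag. -/
def DiagramGeometry.grassmannian {T : Type w} (D : DiagramGeometry.{u, w} T) (J : Set T) :
    PointLineGeometry.{u} where
  Point := {F : Set D.Elem // D.IsFlagOfType J F}
  Line := {L : Set D.Elem // ∃ j ∈ J, D.IsFlagOfType ((J \ {j}) ∪ D.fr j) L}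
  Inc p l := D.IsFlag (p.1 ∪ l.1)

/-! ### Rational vectors and rational subspaces -/

/-- `v` is `R₀`-rational with respect to the basis `E`: all its coordinates lie in `R₀`. -/
def IsRationalVector {ι : Type*} {R : Type u} [DivisionRing R] {V : Type v} [AddCommGroup V]
    [Module R V] (E : Module.Basis ι R V) (R₀ : Subfield R) (x : V) : Prop :=
  ∀ i, E.repr x i ∈ R₀

/-- `X` is `R₀`-rational with respect to the basis `E`: it has a basis (a linearly independent
spanning set) consisting of `R₀`-rational vectors. -/
def IsRational {ι : Type*} {R : Type u} [DivisionRing R] {V : Type v} [AddCommGroup V]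
    [Module R V] (E : Module.Basis ι R V) (R₀ : Subfield R) (X : Submodule R V) : Prop :=
  ∃ s : Set V, (∀ x ∈ s, IsRationalVector E R₀ x) ∧ LinearIndepOn R id s ∧
    Submodule.span R s = X

/-- The sub-division ring of the opposite ring `Kᵐᵒᵖ` with the same elements as `K₀`. Right
`K`-vector spaces are modules over `Kᵐᵒᵖ`, and scalars in `K₀` act as elements of this subring. -/
def oppositeSubfield {K : Type u} [DivisionRing K] (K₀ : Subfield K) : Subfield Kᵐᵒᵖ where
  carrier := {a | a.unop ∈ K₀}
  mul_mem' ha hb := K₀.mul_mem hb ha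
  one_mem' := K₀.one_mem
  add_mem' ha hb := K₀.add_mem ha hb
  zero_mem' := K₀.zero_mem
  neg_mem' ha := K₀.neg_mem ha
  inv_mem' _ ha := K₀.inv_mem ha

/-! ### The geometry of type `A_n` -/

/-- The diagram `A_n`: the path `1 - 2 - ... - n`. -/
def diagramA (n : ℕ) : SimpleGraph ℕ :=
  SimpleGraph.fromRel fun i j => 1 ≤ i ∧ j = i + 1 ∧ j ≤ n

/-- Elements of `A_n`: subspaces of dimension `1, ..., n` (of an `(n+1)`-dimensional space). -/
structure ElemA (n : ℕ) (R : Type u) [DivisionRing R] (V : Type v) [AddCommGroup V]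
    [Module R V] where
  space : Submodule R V
  one_le : 1 ≤ Module.finrank R space
  le_n : Module.finrank R space ≤ n

/-- The geometry of type `A_n` of a vector space `V` of dimension `n + 1` (a module over `R`;
for a right vector space over `K` take `R = Kᵐᵒᵖ`): the elements of type `i` are the
`i`-dimensional subspaces, and incidence is symmetrized inclusion. -/
noncomputable def geomA (n : ℕ) (R : Type u) [DivisionRing R] (V : Type v) [AddCommGroup V]
    [Module R V] : DiagramGeometry.{v, 0} ℕ where
  Elem := ElemA n R V
  typ X := Module.finrank R X.space
  Inc X Y := X.space ≤ Y.space ∨ Y.space ≤ X.space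
  diagram := diagramA n

/-- For a right `K`-vector space `V` of dimension `n + 1` with basis `E`, the `J`-Grassmannian of
`A_n(K)` is generated over the sub-division ring `K₀`: the `J`-flags all of whose elements are
`K₀`-rational with respect to `E` generate it. -/
def IsGeneratedOverA {K : Type u} [DivisionRing K] (n : ℕ) {V : Type v} [AddCommGroup V]
    [Module Kᵐᵒᵖ V] (E : Module.Basis (Fin (n + 1)) Kᵐᵒᵖ V) (J : Set ℕ) (K₀ : Subfield K) :
    Prop :=
  ((geomA n Kᵐᵒᵖ V).grassmannian J).Generates
    {F | ∀ X ∈ F.1, IsRational E (oppositeSubfield K₀) (ElemA.space X)}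

/-! ### The geometry of type `D_n` -/

/-- Labels for the nodes of `D_n`: the dimensions `1, ..., n - 2`, and the symbols `+` and `-`. -/
inductive TypeD where
  | dim (i : ℕ)
  | plus
  | minus

/-- The edges `i - (i+1)` for `1 ≤ i < i + 1 ≤ n - 2`, `(n-2) - (+)` and `(n-2) - (-)`. -/
def edgeD (n : ℕ) : TypeD → TypeD → Prop
  | .dim i, .dim j => 1 ≤ i ∧ j = i + 1 ∧ j + 2 ≤ n
  | .dim i, .plus => 1 ≤ i ∧ i + 2 = n
  | .dim i, .minus => 1 ≤ i ∧ i + 2 = n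
  | _, _ => False

/-- The diagram `D_n`, for `n ≥ 3`. -/
def diagramD (n : ℕ) : SimpleGraph TypeD := SimpleGraph.fromRel (edgeD n)

/-- `X` is totally singular for the quadratic form `q`. -/
def IsTotallySingular {K : Type u} [Field K] {V : Type v} [AddCommGroup V] [Module K V]
    (q : QuadraticForm K V) (X : Submodule K V) : Prop :=
  ∀ x ∈ X, q x = 0

/-- The `n`-dimensional totally singular subspaces. -/
def IsGenerator {K : Type u} [Field K] {V : Type v} [AddCommGroup V] [Module K V] (n : ℕ)
    (q : QuadraticForm K V) (X : Submodule K V) : Prop :=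
  IsTotallySingular q X ∧ Module.finrank K X = n

/-- `X ∼ Y`: the intersection `X ∩ Y` has even codimension in `X`. -/
def SameFamily {K : Type u} [Field K] {V : Type v} [AddCommGroup V] [Module K V]
    (X Y : Submodule K V) : Prop :=
  Even (Module.finrank K X - Module.finrank K (X ⊓ Y : Submodule K V))

/-- `X` is an element of type `t` of `D_n`. The relation `∼` on the `n`-dimensional totally
singular subspaces has two classes. Naming one of them `𝔖⁺` and the other `𝔖⁻` is a free choice,
which is made here by a member `M₀` of the class `𝔖⁺`; then `𝔖⁻` is the complementary class. -/
def HasTypeD {K : Type u} [Field K] {V : Type v} [AddCommGroup V] [Module K V] (n : ℕ)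
    (q : QuadraticForm K V) (M₀ X : Submodule K V) : TypeD → Prop
  | .dim i => 1 ≤ i ∧ i + 2 ≤ n ∧ IsTotallySingular q X ∧ Module.finrank K X = i
  | .plus => IsGenerator n q X ∧ SameFamily X M₀
  | .minus => IsGenerator n q X ∧ ¬ SameFamily X M₀

/-- Elements of `D_n`, with their types. -/
structure ElemD {K : Type u} [Field K] {V : Type v} [AddCommGroup V] [Module K V] (n : ℕ)
    (q : QuadraticForm K V) (M₀ : Submodule K V) where
  space : Submodule K V
  type : TypeD
  hasType : HasTypeD n q M₀ space type

/-- Incidence in `D_n` of subspaces with given types: an element of `𝔖⁺` and an element of `𝔖⁻`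
are incident when they intersect in dimension `n - 1`; in all other cases incidence is symmetrized
inclusion. -/
def IncD {K : Type u} [Field K] {V : Type v} [AddCommGroup V] [Module K V] (n : ℕ)
    (X Y : Submodule K V) : TypeD → TypeD → Prop
  | .plus, .minus => Module.finrank K (X ⊓ Y : Submodule K V) + 1 = n
  | .minus, .plus => Module.finrank K (X ⊓ Y : Submodule K V) + 1 = n
  | _, _ => X ≤ Y ∨ Y ≤ X

/-- The geometry `D_n(K)` of the quadratic form `q` (of Witt index `n` on a space of
dimension `2n`). -/
def geomD {K : Type u} [Field K] {V : Type v} [AddCommGroup V] [Module K V] (n : ℕ)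
    (q : QuadraticForm K V) (M₀ : Submodule K V) : DiagramGeometry.{v, 0} TypeD where
  Elem := ElemD n q M₀
  typ X := X.type
  Inc X Y := IncD n X.space Y.space X.type Y.type
  diagram := diagramD n

/-- `q` has the canonical expression `x₁x₂ + x₃x₄ + ... + x₂ₙ₋₁x₂ₙ` with respect to `E`, where the
basis vectors `e₂ᵢ₊₁, e₂ᵢ₊₂` are indexed as `(i, 0), (i, 1)` for `0 ≤ i < n`. -/
def IsCanonicalExpression {K : Type u} [Field K] {V : Type v} [AddCommGroup V] [Module K V] {n : ℕ}
    (q : QuadraticForm K V) (E : Module.Basis (Fin n × Fin 2) K V) : Prop :=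
  ∀ x, q x = ∑ i : Fin n, E.repr x (i, 0) * E.repr x (i, 1)

/-- The `J`-Grassmannian of `D_n(K)` is generated over the subfield `K₀`: the `J`-flags all of whose
elements are `K₀`-rational with respect to `E` generate it. -/
def IsGeneratedOverD {K : Type u} [Field K] {n : ℕ} {V : Type v} [AddCommGroup V] [Module K V]
    (q : QuadraticForm K V) (E : Module.Basis (Fin n × Fin 2) K V) (M₀ : Submodule K V)
    (J : Set TypeD) (K₀ : Subfield K) : Prop :=
  ((geomD n q M₀).grassmannian J).Generates
    {F | ∀ X ∈ F.1, IsRational E K₀ (ElemD.space X)}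

end JGrass

namespace JGrass

universe u v w

/-! ### Subspaces stable under coordinatewise maps -/

section Stable

variable {ι : Type*} {R : Type*} [DivisionRing R] {V : Type*} [AddCommGroup V] [Module R V]

/-! For each geometry a proper subspace containing all rational flags is exhibited. It consists of
the flags between whose elements a subspace "defined over `K₀`" can be placed in a prescribed way.
"Defined over `K₀`" is expressed by `IsStable`, invariance under the coordinatewise maps given by
`K₀`-linear endomorphisms of the division ring. Rational subspaces are stable, and stability passes
to sums and intersections straight from its definition. Over a field it also passes to orthogonal
complements.

For point-hyperplane flags `(P, H)` of `A_n`, the condition is `P ≤ N ≤ H` for some stable `N`.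
Along a line either `H` is fixed and `P` runs in `P + P'`, where `N + N'` serves, or `P` is fixed
and `H` contains `H ∩ H'`, where `N ∩ N'` serves. For `a ∉ K₀` there is a `K₀`-linear `φ` with `φ 1
≠ 0` and `φ a = 0`. It sends `e₀ + a e₁` to a nonzero multiple of `e₀`, so a hyperplane containing
the former but not the latter gives a flag outside the subspace. The same argument settles the `D_n`
cases involving type `1`, with the element of type `-` as `H`; two distinct members of one family
that share an `(n-2)`-space meet exactly in it, by parity.

For `{+, -}` the condition is `StablyJoined`: one of the two generators is stable, or both contain a
stable `(n-2)`-space. Closure along lines is `isStable_or_isStable`. It rests on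
`isStable_of_hyperplane`: the two generators through a stable totally singular `(n-1)`-space are
themselves stable. A single pair of generators from `exists_generators` escapes all the subspaces
used for `D_n`. -/

/-- Apply an additive map to all coordinates with respect to a basis. -/
noncomputable def coordwise (E : Module.Basis ι R V) (φ : R →+ R) (x : V) : V :=
  E.repr.symm ((E.repr x).mapRange φ φ.map_zero)

@[simp]
theorem repr_coordwise (E : Module.Basis ι R V) (φ : R →+ R) (x : V) (i : ι) :
    E.repr (coordwise E φ x) i = φ (E.repr x i) := by
  simp [coordwise]

theorem coordwise_add (E : Module.Basis ι R V) (φ : R →+ R) (x y : V) :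
    coordwise E φ (x + y) = coordwise E φ x + coordwise E φ y := by
  apply E.ext_elem
  intro i
  simp

/-- A subspace is stable over `R₀` if it is invariant under the coordinatewise application of all
additive endomorphisms of `R` that are linear for right multiplication by `R₀`. -/
def IsStable (E : Module.Basis ι R V) (R₀ : Subfield R) (X : Submodule R V) : Prop :=
  ∀ φ : R →+ R, (∀ c, ∀ r ∈ R₀, φ (c * r) = φ c * r) → ∀ x ∈ X, coordwise E φ x ∈ X

variable {E : Module.Basis ι R V} {R₀ : Subfield R} {X Y : Submodule R V}

theorem IsStable.inf (hX : IsStable E R₀ X) (hY : IsStable E R₀ Y) : IsStable E R₀ (X ⊓ Y) :=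
  fun φ hφ x hx => ⟨hX φ hφ x hx.1, hY φ hφ x hx.2⟩

theorem IsStable.sup (hX : IsStable E R₀ X) (hY : IsStable E R₀ Y) : IsStable E R₀ (X ⊔ Y) := by
  intro φ hφ x hx
  obtain ⟨y, hy, z, hz, rfl⟩ := Submodule.mem_sup.1 hx
  rw [coordwise_add]
  exact Submodule.add_mem_sup (hX φ hφ y hy) (hY φ hφ z hz)

/-- For rational `x`, right `R₀`-linearity gives `φ(c • x) = φ c • x` coordinate by coordinate.
Elements of the span are sums of such `c • x`, so additivity of `φ` is enough. -/
theorem isStable_span {s : Set V} (hs : ∀ x ∈ s, IsRationalVector E R₀ x) :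
    IsStable E R₀ (Submodule.span R s) := by
  intro φ hφ x hx
  induction hx using Submodule.closure_induction with
  | zero =>
    convert Submodule.zero_mem _
    apply E.ext_elem
    simp
  | add x y _ _ hx hy =>
    rw [coordwise_add]
    exact Submodule.add_mem _ hx hy
  | smul_mem c x hx =>
    have : coordwise E φ (c • x) = φ c • x := by
      apply E.ext_elem
      intro i
      simp [hφ _ _ (hs x hx i)]
    rw [this]
    exact Submodule.smul_mem _ _ (Submodule.subset_span hx)

theorem IsRational.isStable (hX : IsRational E R₀ X) : IsStable E R₀ X := by
  obtain ⟨s, hs, -, rfl⟩ := hX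
  exact isStable_span hs

end Stable

/-- If `1 = r a` with `r ∈ K₀`, then `a = r⁻¹ ∈ K₀`. So `1` lies outside the left `K₀`-line of `a`,
and a functional vanishing on that line separates them. -/
theorem exists_linearMap_map_one_ne_zero {K : Type*} [DivisionRing K] {K₀ : Subfield K} {a : K}
    (ha : a ∉ K₀) : ∃ f : K →ₗ[K₀] K₀, f 1 ≠ 0 ∧ f a = 0 := by
  have h : (1 : K) ∉ Submodule.span K₀ {a} := by
    rw [Submodule.mem_span_singleton]
    rintro ⟨r, hr⟩
    apply ha
    have : (r : K) * a = 1 := hr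
    rw [eq_inv_of_mul_eq_one_right this]
    exact K₀.inv_mem r.2
  obtain ⟨f, hf, hle⟩ := Submodule.exists_le_ker_of_notMem h
  exact ⟨f, hf, hle (Submodule.mem_span_singleton_self a)⟩

/-- Right multiplication in `Kᵐᵒᵖ` is left multiplication in `K`, so left `K₀`-linear functionals
are exactly what stability over `Kᵐᵒᵖ` calls for. -/
theorem exists_addMonoidHom_op {K : Type*} [DivisionRing K] {K₀ : Subfield K} {a : K}
    (ha : a ∉ K₀) : ∃ φ : Kᵐᵒᵖ →+ Kᵐᵒᵖ,
      (∀ c, ∀ r ∈ oppositeSubfield K₀, φ (c * r) = φ c * r) ∧ φ 1 ≠ 0 ∧ φ (.op a) = 0 := by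
  obtain ⟨f, h1, h2⟩ := exists_linearMap_map_one_ne_zero ha
  refine ⟨(MulOpposite.opAddEquiv.toAddMonoidHom.comp
    (K₀.subtype.toAddMonoidHom.comp f.toAddMonoidHom)).comp
      MulOpposite.opAddEquiv.symm.toAddMonoidHom, fun c r hr => ?_, ?_, ?_⟩
  · have : f (r.unop * c.unop) = (⟨r.unop, hr⟩ : K₀) * f c.unop :=
      f.map_smul (⟨r.unop, hr⟩ : K₀) c.unop
    simp [this]
  · simpa using h1
  · simpa using h2

theorem exists_addMonoidHom {K : Type*} [Field K] {K₀ : Subfield K} {a : K}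
    (ha : a ∉ K₀) : ∃ φ : K →+ K,
      (∀ c, ∀ r ∈ K₀, φ (c * r) = φ c * r) ∧ φ 1 ≠ 0 ∧ φ a = 0 := by
  obtain ⟨f, h1, h2⟩ := exists_linearMap_map_one_ne_zero ha
  refine ⟨K₀.subtype.toAddMonoidHom.comp f.toAddMonoidHom, fun c r hr => ?_, ?_, ?_⟩
  · have : f (r * c) = (⟨r, hr⟩ : K₀) * f c := f.map_smul (⟨r, hr⟩ : K₀) c
    rw [mul_comm c r]
    simpa [mul_comm] using congrArg Subtype.val this
  · simpa using h1
  · simpa using h2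

/-! ### Flags of diagram geometries -/

section Flags

variable {T : Type w} {D : DiagramGeometry.{u, w} T}

/-- Distinct elements of the same type are never incident. -/
def DiagramGeometry.IncInjective (D : DiagramGeometry.{u, w} T) : Prop :=
  ∀ X Y, D.Inc X Y → D.typ X = D.typ Y → X = Y

variable {J I : Set T} {F F' L : Set D.Elem}

theorem DiagramGeometry.IncInjective.eq_of_mem (hD : D.IncInjective) (hF : D.IsFlag F) {X Y : D.Elem}
    (hX : X ∈ F) (hY : Y ∈ F) (h : D.typ X = D.typ Y) : X = Y := by
  by_contra hne
  exact hne (hD X Y (hF hX hY hne) h)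

theorem DiagramGeometry.IsFlag.inc_of_typ_ne (hF : D.IsFlag F) {X Y : D.Elem}
    (hX : X ∈ F) (hY : Y ∈ F) (h : D.typ X ≠ D.typ Y) : D.Inc X Y :=
  hF hX hY fun e => h (congrArg _ e)

theorem DiagramGeometry.IsFlagOfType.exists_mem (hF : D.IsFlagOfType J F) {t : T} (ht : t ∈ J) :
    ∃ X ∈ F, D.typ X = t := by
  have : t ∈ D.typ '' F := hF.2 ▸ ht
  exact this

theorem DiagramGeometry.IsFlagOfType.typ_mem (hF : D.IsFlagOfType J F) {X : D.Elem} (hX : X ∈ F) :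
    D.typ X ∈ J :=
  hF.2 ▸ Set.mem_image_of_mem _ hX

/-- A line carries every type of `J` other than `j`, so its points agree with it, hence with each
other, off type `j`. Thus distinct points of a line have distinct elements of type `j`. -/
theorem DiagramGeometry.IncInjective.eq_of_line (hD : D.IncInjective) (hF : D.IsFlagOfType J F)
    (hF' : D.IsFlagOfType J F') {j : T} (hL : D.IsFlagOfType ((J \ {j}) ∪ I) L)
    (h : D.IsFlag (F ∪ L)) (h' : D.IsFlag (F' ∪ L)) {X : D.Elem} (hX : X ∈ F) (hX' : X ∈ F')
    (hj : D.typ X = j) : F = F' := by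
  have key : ∀ {A B : Set D.Elem}, D.IsFlagOfType J A → D.IsFlagOfType J B → D.IsFlag (A ∪ L) →
      D.IsFlag (B ∪ L) → X ∈ A → X ∈ B → A ⊆ B := by
    intro A B hA hB hAL hBL hXA hXB Y hY
    by_cases hYj : D.typ Y = j
    · rwa [hD.eq_of_mem hA.1 hY hXA (hYj.trans hj.symm)]
    · obtain ⟨Z, hZ, hZt⟩ := hL.exists_mem (t := D.typ Y) (.inl ⟨hA.typ_mem hY, hYj⟩)
      obtain ⟨Z', hZ', hZt'⟩ := hB.exists_mem (hA.typ_mem hY)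
      rw [hD.eq_of_mem hAL (.inl hY) (.inr hZ) hZt.symm]
      rwa [hD.eq_of_mem hBL (.inr hZ) (.inl hZ') (hZt.trans hZt'.symm)]
  exact (key hF hF' h h' hX hX').antisymm (key hF' hF h' h hX' hX)

end Flags

theorem PointLineGeometry.not_generates {G : PointLineGeometry.{u}} {X S : Set G.Point}
    (hS : G.IsSubspace S) (hXS : X ⊆ S) {p : G.Point} (hp : p ∉ S) : ¬ G.Generates X := by
  intro h
  have : p ∈ G.generatedSubspace X := by rw [show G.generatedSubspace X = _ from h]; trivial
  exact hp (this S ⟨hS, hXS⟩)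

/-! ### Dimension arguments -/

section Dimension

variable {R : Type*} [DivisionRing R] {V : Type*} [AddCommGroup V] [Module R V]
  [FiniteDimensional R V]

open Module

theorem inf_eq_of_finrank_le {X Y W : Submodule R V} (hX : W ≤ X) (hY : W ≤ Y)
    (hXY : finrank R X = finrank R Y) (hne : X ≠ Y) (h : finrank R X ≤ finrank R W + 1) :
    X ⊓ Y = W := by
  symm
  apply Submodule.eq_of_le_of_finrank_le (le_inf hX hY)
  have : X ⊓ Y < X := lt_of_le_of_ne inf_le_left fun e =>
    hne (Submodule.eq_of_le_of_finrank_eq (inf_eq_left.1 e) hXY)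
  have := Submodule.finrank_lt_finrank_of_lt this
  omega

theorem sup_eq_of_finrank_le {X Y W : Submodule R V} (hX : X ≤ W) (hY : Y ≤ W)
    (hXY : finrank R X = finrank R Y) (hne : X ≠ Y) (h : finrank R W ≤ finrank R X + 1) :
    X ⊔ Y = W := by
  apply Submodule.eq_of_le_of_finrank_le (sup_le hX hY)
  have : X < X ⊔ Y := lt_of_le_of_ne le_sup_left fun e =>
    hne (Submodule.eq_of_le_of_finrank_eq (sup_eq_left.1 e.symm) hXY.symm).symm
  have := Submodule.finrank_lt_finrank_of_lt this
  omega

theorem eq_sup_span_singleton {Q X : Submodule R V} (hQ : Q ≤ X)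
    (h : finrank R X ≤ finrank R Q + 1) {x : V} (hx : x ∈ X) (hxQ : x ∉ Q) :
    Q ⊔ Submodule.span R {x} = X := by
  apply Submodule.eq_of_le_of_finrank_le (sup_le hQ (by simpa using hx))
  have : Q < Q ⊔ Submodule.span R {x} := lt_of_le_of_ne le_sup_left fun e =>
    hxQ (by rw [e]; exact Submodule.mem_sup_right (Submodule.mem_span_singleton_self x))
  have := Submodule.finrank_lt_finrank_of_lt this
  omega

end Dimension

/-! ### Type `A_n` -/

section TypeA

open Module

variable {R : Type u} [DivisionRing R] {V : Type v} [AddCommGroup V] [Module R V]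
  [FiniteDimensional R V] {n : ℕ}

omit [FiniteDimensional R V] in
theorem ElemA.ext' {X Y : ElemA n R V} (h : X.space = Y.space) : X = Y := by
  cases X; cases Y; cases h; rfl

theorem le_of_symm_le {X Y : Submodule R V} (h : X ≤ Y ∨ Y ≤ X)
    (hd : finrank R X ≤ finrank R Y) : X ≤ Y := by
  rcases h with h | h
  · exact h
  · exact (Submodule.eq_of_le_of_finrank_le h hd).ge

theorem geomA_incInjective : (geomA n R V).IncInjective :=
  fun _ _ h ht => ElemA.ext' ((le_of_symm_le h ht.le).antisymm (le_of_symm_le h.symm ht.ge))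

theorem geomA_le_of_mem {F : Set (geomA n R V).Elem} (hF : (geomA n R V).IsFlag F)
    {X Y : ElemA n R V} (hX : X ∈ F) (hY : Y ∈ F)
    (h : finrank R X.space < finrank R Y.space) : X.space ≤ Y.space :=
  le_of_symm_le (hF.inc_of_typ_ne hX hY h.ne) h.le

/-- The point-hyperplane flags with a stable subspace between the point and the hyperplane. -/
def stableFlagsA {ι : Type*} (n : ℕ) (E : Basis ι R V) (R₀ : Subfield R) (J : Set ℕ) :
    Set ((geomA n R V).grassmannian J).Point :=
  {F | ∃ N, IsStable E R₀ N ∧ ∀ P ∈ F.1, ∀ H ∈ F.1, finrank R (ElemA.space P) = 1 →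
    finrank R (ElemA.space H) = n → P.space ≤ N ∧ N ≤ H.space}

/-- The two kinds of line are dual: with the hyperplane fixed the witnesses are added, with the
point fixed they are intersected. -/
theorem isSubspace_stableFlagsA {ι : Type*} (hn : 3 ≤ n) (hV : finrank R V = n + 1)
    (E : Basis ι R V) (R₀ : Subfield R) :
    ((geomA n R V).grassmannian {1, n}).IsSubspace (stableFlagsA n E R₀ {1, n}) := by
  have hD := geomA_incInjective (n := n) (R := R) (V := V)
  rintro ⟨L, j, hj, hL⟩ ⟨F, hF⟩ ⟨N, hN, hNF⟩ ⟨F', hF'⟩ ⟨N', hN', hNF'⟩ hne hFL hFL' ⟨G, hG⟩ hGL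
  change (geomA n R V).IsFlag (F ∪ L) at hFL
  change (geomA n R V).IsFlag (F' ∪ L) at hFL'
  change (geomA n R V).IsFlag (G ∪ L) at hGL
  replace hne : F ≠ F' := fun h => hne (Subtype.ext h)
  obtain ⟨P, hP, hPt⟩ := hF.exists_mem (t := 1) (by simp)
  obtain ⟨P', hP', hPt'⟩ := hF'.exists_mem (t := 1) (by simp)
  obtain ⟨H, hH, hHt⟩ := hF.exists_mem (t := n) (by simp)
  obtain ⟨H', hH', hHt'⟩ := hF'.exists_mem (t := n) (by simp)
  have h1 := hNF P hP H hH hPt hHt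
  have h2 := hNF' P' hP' H' hH' hPt' hHt'
  change finrank R (ElemA.space P) = 1 at hPt
  change finrank R (ElemA.space P') = 1 at hPt'
  change finrank R (ElemA.space H) = n at hHt
  change finrank R (ElemA.space H') = n at hHt'
  rcases hj with rfl | rfl
  · obtain ⟨M, hM, hMt⟩ := hL.exists_mem (t := 2) (.inr (by
      simp [DiagramGeometry.fr, geomA, diagramA]; omega))
    obtain ⟨K, hK, hKt⟩ := hL.exists_mem (t := n) (.inl (by simp; omega))
    change finrank R (ElemA.space M) = 2 at hMt
    change finrank R (ElemA.space K) = n at hKt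
    have hPP : P.space ≠ P'.space := fun e =>
      hne (hD.eq_of_line hF hF' hL hFL hFL' hP (by rwa [ElemA.ext' e]) hPt)
    have e1 : H = K := hD.eq_of_mem hFL (.inl hH) (.inr hK) (hHt.trans hKt.symm)
    have e2 : H' = K := hD.eq_of_mem hFL' (.inl hH') (.inr hK) (hHt'.trans hKt.symm)
    have e3 : P.space ⊔ P'.space = M.space := sup_eq_of_finrank_le
      (geomA_le_of_mem hFL (.inl hP) (.inr hM) (by omega))
      (geomA_le_of_mem hFL' (.inl hP') (.inr hM) (by omega)) (by omega) hPP (by omega)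
    refine ⟨N ⊔ N', hN.sup hN', fun P'' hP'' H'' hH'' hPt'' hHt'' => ⟨?_, ?_⟩⟩
    · calc P''.space ≤ M.space := geomA_le_of_mem hGL (.inl hP'') (.inr hM) (by omega)
        _ = P.space ⊔ P'.space := e3.symm
        _ ≤ N ⊔ N' := sup_le_sup h1.1 h2.1
    · have e4 : H'' = K := hD.eq_of_mem hGL (.inl hH'') (.inr hK) (hHt''.trans hKt.symm)
      rw [e4]
      exact sup_le (e1 ▸ h1.2) (e2 ▸ h2.2)
  -- The substitution has replaced `n` by `j`, so `j - 1` is the neighbour of the last node.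
  · obtain ⟨M, hM, hMt⟩ := hL.exists_mem (t := j - 1) (.inr (by
      simp [DiagramGeometry.fr, geomA, diagramA]; omega))
    obtain ⟨K, hK, hKt⟩ := hL.exists_mem (t := 1) (.inl (by simp; omega))
    change finrank R (ElemA.space M) = j - 1 at hMt
    change finrank R (ElemA.space K) = 1 at hKt
    have hPP : H.space ≠ H'.space := fun e =>
      hne (hD.eq_of_line hF hF' hL hFL hFL' hH (by rwa [ElemA.ext' e]) hHt)
    have e1 : P = K := hD.eq_of_mem hFL (.inl hP) (.inr hK) (hPt.trans hKt.symm)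
    have e2 : P' = K := hD.eq_of_mem hFL' (.inl hP') (.inr hK) (hPt'.trans hKt.symm)
    have e3 : H.space ⊓ H'.space = M.space := inf_eq_of_finrank_le
      (geomA_le_of_mem hFL (.inr hM) (.inl hH) (by omega))
      (geomA_le_of_mem hFL' (.inr hM) (.inl hH') (by omega)) (by omega) hPP (by omega)
    refine ⟨N ⊓ N', hN.inf hN', fun P'' hP'' H'' hH'' hPt'' hHt'' => ⟨?_, ?_⟩⟩
    · have e4 : P'' = K := hD.eq_of_mem hGL (.inl hP'') (.inr hK) (hPt''.trans hKt.symm)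
      rw [e4]
      exact le_inf (e1 ▸ h1.1) (e2 ▸ h2.1)
    · calc N ⊓ N' ≤ H.space ⊓ H'.space := inf_le_inf h1.2 h2.2
        _ = M.space := e3
        _ ≤ H''.space := geomA_le_of_mem hGL (.inr hM) (.inl hH'') (by omega)

theorem exists_notMem_stableFlagsA (hn : 3 ≤ n) (E : Basis (Fin (n + 1)) R V)
    {R₀ : Subfield R} {a : R} (ha : a ≠ 0)
    (hφ : ∃ φ : R →+ R, (∀ c, ∀ r ∈ R₀, φ (c * r) = φ c * r) ∧ φ 1 ≠ 0 ∧ φ a = 0) :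
    ∃ F, F ∉ stableFlagsA n E R₀ {1, n} := by
  obtain ⟨φ, hφ, h1, h2⟩ := hφ
  have h01 : (0 : Fin (n + 1)) ≠ 1 := by
    intro h
    have := congrArg Fin.val h
    simp [Nat.mod_eq_of_lt (show 1 < n + 1 by omega)] at this
  -- `f x = x₀ a - x₁` vanishes at `u = e₀ + a e₁` but not at `φ(u) = φ(1) e₀`.
  let f : V →ₗ[R] R := (LinearMap.toSpanSingleton R R a).comp (E.coord 0) - E.coord 1
  let u : V := E 0 + a • E 1
  have hf0 : f (E 0) = a := by simp [f, h01.symm]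
  have hfu : f u = 0 := by simp [f, u, h01, h01.symm]
  have hfn : f ≠ 0 := fun h => ha (by rw [← hf0, h]; rfl)
  have hu : u ≠ 0 := by
    intro h
    have := congrArg (fun x => E.repr x 0) h
    simp [u, h01.symm] at this
  have hdim : finrank R (LinearMap.ker f) = n := by
    have := LinearMap.finrank_range_add_finrank_ker f
    rw [LinearMap.range_eq_top.mpr (LinearMap.surjective hfn), finrank_top, finrank_self,
      finrank_eq_card_basis E, Fintype.card_fin] at this
    omega
  have hdimu : finrank R (Submodule.span R {u}) = 1 := finrank_span_singleton hu
  let P : ElemA n R V := ⟨Submodule.span R {u}, hdimu.ge, by omega⟩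
  let H : ElemA n R V := ⟨LinearMap.ker f, by omega, hdim.le⟩
  have hPH : P.space ≤ H.space := by simpa [P, H] using hfu
  have hflag : (geomA n R V).IsFlagOfType {1, n} {P, H} := by
    constructor
    · intro X hX Y hY _
      rcases hX with rfl | rfl <;> rcases hY with rfl | rfl
      · exact .inl le_rfl
      · exact .inl hPH
      · exact .inr hPH
      · exact .inl le_rfl
    · refine (Set.image_pair (geomA n R V).typ P H).trans ?_
      rw [show (geomA n R V).typ P = 1 from hdimu, show (geomA n R V).typ H = n from hdim]
  refine ⟨⟨{P, H}, hflag⟩, ?_⟩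
  rintro ⟨N, hN, hNF⟩
  obtain ⟨hPN, hNH⟩ := hNF P (.inl rfl) H (.inr rfl) hdimu hdim
  have hmem := hNH (hN φ hφ u (hPN (Submodule.mem_span_singleton_self u)))
  have : coordwise E φ u = φ 1 • E 0 := by
    apply E.ext_elem
    intro i
    rw [repr_coordwise]
    by_cases hi0 : i = 0
    · subst hi0; simp [u, h01.symm]
    · by_cases hi1 : i = 1
      · subst hi1; simp [u, h01, h2]
      · simp [u, Ne.symm hi0, Ne.symm hi1]
  rw [this] at hmem
  have : f (φ 1 • E 0) = 0 := hmem
  rw [map_smul, hf0, smul_eq_mul] at this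
  exact (mul_ne_zero h1 ha) this

end TypeA

/-! ### Non-generation for `A_n` -/

theorem not_isGeneratedOverA {K : Type u} [DivisionRing K] {n : ℕ} (hn : 3 ≤ n) {V : Type v}
    [AddCommGroup V] [Module Kᵐᵒᵖ V] (E : Module.Basis (Fin (n + 1)) Kᵐᵒᵖ V) {K₀ : Subfield K}
    (hK : K₀ ≠ ⊤) : ¬ IsGeneratedOverA n E {1, n} K₀ := by
  have := E.finiteDimensional_of_finite
  obtain ⟨a, ha⟩ : ∃ a, a ∉ K₀ := by
    by_contra! h
    exact hK (eq_top_iff.2 fun x _ => h x)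
  have ha0 : a ≠ 0 := fun h => ha (h ▸ K₀.zero_mem)
  obtain ⟨F, hF⟩ := exists_notMem_stableFlagsA (R₀ := oppositeSubfield K₀) hn E
    (a := .op a) (by simpa using ha0) (exists_addMonoidHom_op ha)
  refine PointLineGeometry.not_generates
    (isSubspace_stableFlagsA hn (by simp [Module.finrank_eq_card_basis E]) E _) ?_ hF
  rintro ⟨G, hG⟩ hrat
  obtain ⟨P, hP, hPt⟩ := hG.exists_mem (t := 1) (by simp)
  -- In a rational flag the point itself serves as the intermediate stable subspace.
  refine ⟨P.space, (hrat P hP).isStable, fun P' hP' H hH hPt' hHt => ?_⟩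
  have e : P' = P := geomA_incInjective.eq_of_mem hG.1 hP' hP (hPt'.trans hPt.symm)
  subst e
  exact ⟨le_rfl, geomA_le_of_mem hG.1 hP' hH (by omega)⟩

/-! ### Stable subspaces over fields -/

section StableField

variable {ι : Type*} {K : Type*} [Field K] {V : Type*} [AddCommGroup V] [Module K V]
  {E : Module.Basis ι K V} {K₀ : Subfield K} {X Y : Submodule K V}

/-- Expand the coordinates of `x` in a `K₀`-basis `b` of `K`: then `x = ∑ b_k φ_k(x)` with `φ_k` the
`k`-th coordinate functional. Each `φ_k(x)` is rational, and lies in `X` by stability. -/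
theorem IsStable.mem_span (hX : IsStable E K₀ X) {x : V} (hx : x ∈ X) :
    x ∈ Submodule.span K {y | y ∈ X ∧ IsRationalVector E K₀ y} := by
  classical
  let b := Module.Basis.ofVectorSpace K₀ K
  let φ (k) : K →+ K := K₀.subtype.toAddMonoidHom.comp (b.coord k).toAddMonoidHom
  have hφ (k) (c : K) : φ k c = (b.repr c k : K) := rfl
  have hφ' (k) (c : K) (r : K) (hr : r ∈ K₀) : φ k (c * r) = φ k c * r := by
    have : b.coord k (r * c) = (⟨r, hr⟩ : K₀) * b.coord k c := (b.coord k).map_smul ⟨r, hr⟩ c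
    rw [mul_comm c, mul_comm _ r]
    exact congrArg Subtype.val this
  let s := (E.repr x).support.biUnion fun i => (b.repr (E.repr x i)).support
  have key : x = ∑ k ∈ s, b k • coordwise E (φ k) x := by
    apply E.ext_elem
    intro i
    simp only [map_sum, map_smul, Finsupp.coe_finsetSum, Finset.sum_apply, Finsupp.smul_apply,
      repr_coordwise, smul_eq_mul, hφ]
    by_cases hi : E.repr x i = 0
    · simp [hi]
    · have := b.linearCombination_repr (E.repr x i)
      rw [Finsupp.linearCombination_apply, Finsupp.sum_of_support_subset (s := s)] at this
      · conv_lhs => rw [← this]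
        refine Finset.sum_congr rfl fun k _ => ?_
        rw [mul_comm]; rfl
      · exact Finset.subset_biUnion_of_mem (fun i => (b.repr (E.repr x i)).support)
          (Finsupp.mem_support_iff.2 hi)
      · simp
  rw [key]
  refine Submodule.sum_mem _ fun k _ => Submodule.smul_mem _ _ (Submodule.subset_span ⟨?_, ?_⟩)
  · exact hX _ (hφ' k) x hx
  · intro i
    rw [repr_coordwise, hφ]
    exact Subtype.property _

theorem IsStable.exists_notMem (hX : IsStable E K₀ X) (h : ¬ X ≤ Y) :
    ∃ x ∈ X, IsRationalVector E K₀ x ∧ x ∉ Y := by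
  by_contra! hc
  exact h fun x hx => Submodule.span_le.2 (fun y hy => hc y hy.1 hy.2) (hX.mem_span hx)

end StableField

/-! ### Totally singular subspaces -/

section Singular

open Module

variable {K : Type u} [Field K] {V : Type v} [AddCommGroup V] [Module K V] {n : ℕ}
  {q : QuadraticForm K V} {E : Basis (Fin n × Fin 2) K V}

/-- The orthogonal subspace with respect to the polar form of `q`. -/
def perp (q : QuadraticForm K V) (X : Submodule K V) : Submodule K V :=
  LinearMap.BilinForm.orthogonal q.polarBilin X

theorem mem_perp {X : Submodule K V} {y : V} :
    y ∈ perp q X ↔ ∀ x ∈ X, QuadraticMap.polar q x y = 0 := by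
  simp [perp, LinearMap.BilinForm.mem_orthogonal_iff]

theorem perp_anti {X Y : Submodule K V} (h : X ≤ Y) : perp q Y ≤ perp q X :=
  fun _ hy => mem_perp.2 fun x hx => mem_perp.1 hy x (h hx)

theorem le_perp_comm {X Y : Submodule K V} : X ≤ perp q Y ↔ Y ≤ perp q X := by
  constructor <;> intro h x hx <;> refine mem_perp.2 fun y hy => ?_ <;>
    rw [QuadraticMap.polar_comm] <;> exact mem_perp.1 (h hy) x hx

theorem perp_sup (X Y : Submodule K V) : perp q (X ⊔ Y) = perp q X ⊓ perp q Y := by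
  apply le_antisymm
  · exact le_inf (perp_anti le_sup_left) (perp_anti le_sup_right)
  · exact le_perp_comm.1 (sup_le (le_perp_comm.1 inf_le_left) (le_perp_comm.1 inf_le_right))

theorem IsTotallySingular.le_perp {X : Submodule K V} (hX : IsTotallySingular q X) :
    X ≤ perp q X := by
  refine fun y hy => mem_perp.2 fun x hx => ?_
  simp [QuadraticMap.polar, hX _ (X.add_mem hx hy), hX x hx, hX y hy]

theorem IsTotallySingular.mono {X Y : Submodule K V} (hY : IsTotallySingular q Y) (h : X ≤ Y) :
    IsTotallySingular q X :=
  fun x hx => hY x (h hx)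

theorem IsTotallySingular.sup {X Y : Submodule K V} (hX : IsTotallySingular q X)
    (hY : IsTotallySingular q Y) (h : X ≤ perp q Y) : IsTotallySingular q (X ⊔ Y) := by
  intro z hz
  obtain ⟨x, hx, y, hy, rfl⟩ := Submodule.mem_sup.1 hz
  have : QuadraticMap.polar q y x = 0 := mem_perp.1 (h hx) y hy
  rw [QuadraticMap.polar_comm, QuadraticMap.polar, hX x hx, hY y hy] at this
  simpa using this

theorem isTotallySingular_span_singleton {x : V} (hx : q x = 0) :
    IsTotallySingular q (Submodule.span K {x}) := by
  intro y hy
  obtain ⟨c, rfl⟩ := Submodule.mem_span_singleton.1 hy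
  simp [QuadraticMap.map_smul, hx]

/-! ### Generators of the hyperbolic quadric and their two families -/

namespace IsCanonicalExpression

variable (hE : IsCanonicalExpression q E)
include hE

theorem polar_eq (x y : V) : QuadraticMap.polar q x y =
    ∑ i, (E.repr x (i, 0) * E.repr y (i, 1) + E.repr x (i, 1) * E.repr y (i, 0)) := by
  rw [QuadraticMap.polar, hE, hE, hE, ← Finset.sum_sub_distrib, ← Finset.sum_sub_distrib]
  refine Finset.sum_congr rfl fun i _ => ?_
  simp only [map_add, Finsupp.add_apply]
  ring

/-- Pairing with the partner basis vector reads off each coordinate, in every characteristic. -/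
theorem nondegenerate : LinearMap.BilinForm.Nondegenerate q.polarBilin := by
  have h (x : V) (hx : ∀ y, QuadraticMap.polar q x y = 0) : x = 0 := by
    apply E.ext_elem
    rintro ⟨i, j⟩
    fin_cases j
    · simpa [hE.polar_eq, Finsupp.single_apply] using hx (E (i, 1))
    · simpa [hE.polar_eq, Finsupp.single_apply] using hx (E (i, 0))
  exact ⟨fun x hx => h x hx, fun x hx => h x fun y => by
    rw [QuadraticMap.polar_comm]; exact hx y⟩

omit hE in
theorem _root_.JGrass.finrank_hyperbolic (E : Basis (Fin n × Fin 2) K V) :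
    finrank K V = 2 * n := by
  rw [finrank_eq_card_basis E]; simp [mul_comm]

theorem finrank_perp (X : Submodule K V) : finrank K X + finrank K (perp q X) = 2 * n := by
  have := E.finiteDimensional_of_finite
  have h := LinearMap.BilinForm.finrank_orthogonal hE.nondegenerate X
  have h' := Submodule.finrank_le X
  rw [finrank_hyperbolic E] at h h'
  change finrank K (perp q X) = _ at h
  omega

theorem finrank_le {X : Submodule K V} (hX : IsTotallySingular q X) : finrank K X ≤ n := by
  have := E.finiteDimensional_of_finite
  have h := hE.finrank_perp X
  have := Submodule.finrank_mono hX.le_perp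
  omega

theorem perp_eq {X : Submodule K V} (hX : IsGenerator n q X) : perp q X = X := by
  have := E.finiteDimensional_of_finite
  have h := hE.finrank_perp X
  have := hX.2
  exact (Submodule.eq_of_le_of_finrank_le hX.1.le_perp (by omega)).symm

/-- Since `M = M⊥`, the left side is `(M + Q)⊥`; count dimensions. -/
theorem finrank_inf_perp {M Q : Submodule K V} (hM : IsGenerator n q M)
    (hQ : finrank K Q + 1 = n) :
    finrank K (M ⊓ perp q Q : Submodule K V) = finrank K (M ⊓ Q : Submodule K V) + 1 := by
  have := E.finiteDimensional_of_finite
  have h1 := hE.finrank_perp (M ⊔ Q)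
  rw [perp_sup, hE.perp_eq hM] at h1
  have h2 := Submodule.finrank_sup_add_finrank_inf_eq M Q
  have := hM.2
  omega

/-- For rational `x`, `φ` commutes with pairing: `φ(B(x, y)) = B(x, φ(y))`, where `B` is the polar
form. As `X` is spanned by its rational vectors, orthogonality to `X` survives `φ`. -/
theorem isStable_perp {K₀ : Subfield K} {X : Submodule K V} (hX : IsStable E K₀ X) :
    IsStable E K₀ (perp q X) := by
  intro φ hφ y hy
  have hle : {y | y ∈ X ∧ IsRationalVector E K₀ y} ⊆ (perp q (Submodule.span K {coordwise E φ y}) :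
      Submodule K V) := by
    rintro x ⟨hx, hxr⟩
    refine mem_perp.2 fun z hz => ?_
    obtain ⟨c, rfl⟩ := Submodule.mem_span_singleton.1 hz
    have h0 : QuadraticMap.polar q x y = 0 := mem_perp.1 hy x hx
    have h1 : φ (QuadraticMap.polar q x y) = QuadraticMap.polar q x (coordwise E φ y) := by
      rw [hE.polar_eq, hE.polar_eq, map_sum]
      refine Finset.sum_congr rfl fun i _ => ?_
      rw [map_add, mul_comm, hφ _ _ (hxr _), mul_comm (E.repr x (i, 1)), hφ _ _ (hxr _)]
      simp only [repr_coordwise]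
      ring
    rw [QuadraticMap.polar_smul_left, QuadraticMap.polar_comm, ← h1, h0, map_zero, smul_zero]
  refine mem_perp.2 fun x hx => ?_
  rw [QuadraticMap.polar_comm]
  exact mem_perp.1 (Submodule.span_le.2 hle (hX.mem_span hx)) _
    (Submodule.mem_span_singleton_self _)

/-- At most two generators contain a given totally singular subspace of dimension `n - 1`. -/
theorem eq_or_eq {Q X Y Z : Submodule K V} (hX : IsGenerator n q X) (hY : IsGenerator n q Y)
    (hZ : IsGenerator n q Z) (hQ : finrank K Q + 1 = n) (hQX : Q ≤ X) (hQY : Q ≤ Y) (hQZ : Q ≤ Z)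
    (hXY : X ≠ Y) : Z = X ∨ Z = Y := by
  have := E.finiteDimensional_of_finite
  have hXn := hX.2
  have hYn := hY.2
  have hZn := hZ.2
  by_cases hZX : Z ≤ X
  · exact .inl (Submodule.eq_of_le_of_finrank_eq hZX (by omega))
  right
  obtain ⟨z, hz, hzX⟩ := SetLike.not_le_iff_exists.1 hZX
  -- `Z` lies in `Q⊥ = X + Y`, so a vector of `Z` outside `X` splits as `x + y`, and its singularity
  -- forces `B(x, y) = 0`. If `x ∉ Q` this makes `Y` orthogonal to `X = X⊥`, which is absurd; so `x
  -- ∈ Q` and `Z = Q + ⟨y⟩ = Y`.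
  have hsup : X ⊔ Y = perp q Q := by
    apply sup_eq_of_finrank_le _ _ (by omega) hXY
    · have := hE.finrank_perp Q
      omega
    · rw [← hE.perp_eq hX]; exact perp_anti hQX
    · rw [← hE.perp_eq hY]; exact perp_anti hQY
  have hzs : z ∈ X ⊔ Y := by
    rw [hsup]
    exact perp_anti hQZ (hZ.1.le_perp hz)
  obtain ⟨x, hx, y, hy, rfl⟩ := Submodule.mem_sup.1 hzs
  have hB : QuadraticMap.polar q x y = 0 := by
    simp [QuadraticMap.polar, hZ.1 _ hz, hX.1 x hx, hY.1 y hy]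
  have hyQ : y ∉ Q := fun h => hzX (X.add_mem hx (hQX h))
  by_cases hxQ : x ∈ Q
  · have hyZ : y ∈ Z := by simpa using Z.sub_mem hz (hQZ hxQ)
    rw [← eq_sup_span_singleton hQZ (by omega) hyZ hyQ,
      eq_sup_span_singleton hQY (by omega) hy hyQ]
  · exfalso
    have hXs := eq_sup_span_singleton hQX (by omega) hx hxQ
    have hYX : Y ≤ perp q X := by
      rw [← hXs, perp_sup]
      refine le_inf (hY.1.le_perp.trans (perp_anti hQY)) ?_
      rw [← eq_sup_span_singleton hQY (by omega) hy hyQ]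
      refine sup_le ?_ ?_
      · rw [le_perp_comm, Submodule.span_singleton_le_iff_mem]
        exact perp_anti hQX (hX.1.le_perp hx)
      · rw [Submodule.span_singleton_le_iff_mem, mem_perp]
        intro w hw
        obtain ⟨c, rfl⟩ := Submodule.mem_span_singleton.1 hw
        simp [QuadraticMap.polar_smul_left, hB]
    rw [hE.perp_eq hX] at hYX
    exact hXY (Submodule.eq_of_le_of_finrank_eq hYX (by omega)).symm

/-- The generator spanned by `Q` and a singular vector orthogonal to it. -/
theorem isGenerator_sup_span_singleton {Q : Submodule K V} (hQ : IsTotallySingular q Q)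
    (hQn : finrank K Q + 1 = n) {x : V} (hx : x ∈ perp q Q) (hxQ : x ∉ Q) (hqx : q x = 0) :
    IsGenerator n q (Q ⊔ Submodule.span K {x}) := by
  have := E.finiteDimensional_of_finite
  have hs : IsTotallySingular q (Q ⊔ Submodule.span K {x}) :=
    hQ.sup (isTotallySingular_span_singleton hqx)
      (le_perp_comm.1 ((Submodule.span_singleton_le_iff_mem _ _).2 hx))
  refine ⟨hs, (hE.finrank_le hs).antisymm ?_⟩
  have : Q < Q ⊔ Submodule.span K {x} := lt_of_le_of_ne le_sup_left fun e =>
    hxQ (by rw [e]; exact Submodule.mem_sup_right (Submodule.mem_span_singleton_self x))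
  have := Submodule.finrank_lt_finrank_of_lt this
  omega

/-- Of two generators meeting in dimension `n - 1` exactly one is in the same family as `M`. -/
theorem sameFamily_iff_not {M X Y : Submodule K V} (hM : IsGenerator n q M)
    (hX : IsGenerator n q X) (hY : IsGenerator n q Y)
    (h : finrank K (X ⊓ Y : Submodule K V) + 1 = n) : SameFamily X M ↔ ¬ SameFamily Y M := by
  have := E.finiteDimensional_of_finite
  have hXn := hX.2
  have hYn := hY.2
  have hMn := hM.2
  set Q := X ⊓ Y with hQ
  have hXY : X ≠ Y := by
    rintro rfl
    rw [inf_idem] at hQ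
    rw [hQ] at h
    omega
  have hQs : IsTotallySingular q Q := hX.1.mono inf_le_left
  have hdim := hE.finrank_inf_perp hM h
  -- the generators through `Q`: exactly one of them contains `M ⊓ perp q Q`
  have key : ∀ {A B : Submodule K V}, IsGenerator n q A → IsGenerator n q B → Q = A ⊓ B →
      M ⊓ perp q Q ≤ A →
      finrank K (A ⊓ M : Submodule K V) = finrank K (M ⊓ Q : Submodule K V) + 1 ∧
      finrank K (B ⊓ M : Submodule K V) = finrank K (M ⊓ Q : Submodule K V) := by
    intro A B hA hB hAB hle
    have hQA : Q ≤ A := hAB ▸ inf_le_left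
    have hQB : Q ≤ B := hAB ▸ inf_le_right
    constructor
    · rw [← hdim, le_antisymm (le_inf inf_le_right
        (inf_le_left.trans (hA.1.le_perp.trans (perp_anti hQA)))) (le_inf hle inf_le_left)]
    · have : B ⊓ M ≤ A := fun x hx => hle ⟨hx.2, perp_anti hQB (hB.1.le_perp hx.1)⟩
      rw [le_antisymm (le_inf inf_le_right (hAB ▸ le_inf this inf_le_left))
        (le_inf (inf_le_right.trans hQB) inf_le_left)]
  have hMQ : M ⊓ Q ≤ M := inf_le_left
  have hle := Submodule.finrank_mono hMQ
  obtain ⟨x, hx, hxQ⟩ : ∃ x ∈ M ⊓ perp q Q, x ∉ Q := by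
    by_contra! hc
    have : M ⊓ perp q Q ≤ M ⊓ Q := le_inf inf_le_left hc
    have := Submodule.finrank_mono this
    omega
  have hMx : M ⊓ Q ⊔ Submodule.span K {x} = M ⊓ perp q Q :=
    eq_sup_span_singleton (inf_le_inf_left _ (hQs.le_perp)) (by omega) hx fun h => hxQ h.2
  have hle' : M ⊓ perp q Q ≤ Q ⊔ Submodule.span K {x} := by
    rw [← hMx]; exact sup_le_sup_right inf_le_right _
  -- The bound `a ≤ n` keeps the truncated subtraction from spoiling parity.
  have hpar : ∀ {d a b : ℕ}, a = d + 1 → b = d → a ≤ n →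
      (Even (n - a) ↔ ¬ Even (n - b)) := by
    intro d a b ha hb hle
    rw [show n - b = (n - a) + 1 by omega, Nat.even_add_one, not_not]
  -- `Q + ⟨x⟩` contains `M ∩ Q⊥` and is a generator through `Q`, hence is `X` or `Y`.
  have hN := hE.isGenerator_sup_span_singleton hQs h hx.2 hxQ (hM.1 x hx.1)
  have hAM (A : Submodule K V) (hA : finrank K A = n) : finrank K (A ⊓ M : Submodule K V) ≤ n :=
    hA ▸ Submodule.finrank_mono inf_le_left
  unfold SameFamily
  rw [hXn, hYn]
  rcases hE.eq_or_eq hX hY hN h inf_le_left inf_le_right le_sup_left hXY with e | e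
  · obtain ⟨h1, h2⟩ := key hX hY rfl (e ▸ hle')
    exact hpar h1 h2 (hAM X hXn)
  · obtain ⟨h1, h2⟩ := key hY hX (inf_comm X Y) (e ▸ hle')
    have := hpar h1 h2 (hAM Y hYn)
    tauto

/-- A generator with a stable subspace of dimension `n - 1` is stable. -/
theorem isStable_of_hyperplane {K₀ : Subfield K} {Q Z : Submodule K V} (hZ : IsGenerator n q Z)
    (hQ : IsStable E K₀ Q) (hQn : finrank K Q + 1 = n) (hQZ : Q ≤ Z) : IsStable E K₀ Z := by
  classical
  have := E.finiteDimensional_of_finite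
  have hZn := hZ.2
  have hQs : IsTotallySingular q Q := hZ.1.mono hQZ
  have hQp := hE.isStable_perp hQ
  have hdp := hE.finrank_perp Q
  -- a rational generator
  let M : Submodule K V := Submodule.span K (Set.range fun i : Fin n => E (i, 0))
  have hMst : IsStable E K₀ M := isStable_span (by
    rintro _ ⟨i, rfl⟩ j
    simp only [Basis.repr_self, Finsupp.single_apply]
    split_ifs
    exacts [K₀.one_mem, K₀.zero_mem])
  have hM : IsGenerator n q M := by
    constructor
    · intro x hx
      have hx1 (i) : E.repr x (i, 1) = 0 := by
        have : M ≤ LinearMap.ker (E.coord (i, 1)) := by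
          rw [Submodule.span_le]
          rintro _ ⟨j, rfl⟩
          simp
        exact this hx
      rw [hE x]
      simp [hx1]
    · rw [finrank_span_eq_card, Fintype.card_fin]
      exact E.linearIndependent.comp _ fun i j h => (Prod.ext_iff.1 h).1
  -- `Q⊥ / Q` is a hyperbolic plane. Rational representatives of its two singular lines are sought:
  -- `u` comes from `M`, and the second is a correction of a rational `v` by a multiple of `u`.
  have hdim := hE.finrank_inf_perp hM hQn
  obtain ⟨u, hu, hur, huQ⟩ := (hMst.inf hQp).exists_notMem (Y := Q) (by
    intro hc
    have : M ⊓ perp q Q ≤ M ⊓ Q := le_inf inf_le_left hc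
    have := Submodule.finrank_mono this
    omega)
  have hN := hE.isGenerator_sup_span_singleton hQs hQn hu.2 huQ (hM.1 u hu.1)
  have hstab {x : V} (hx : IsRationalVector E K₀ x) :
      IsStable E K₀ (Q ⊔ Submodule.span K {x}) := hQ.sup (isStable_span (by simpa using hx))
  by_cases hZN : Z = Q ⊔ Submodule.span K {u}
  · rw [hZN]; exact hstab hur
  obtain ⟨v, hv, hvr, hvN⟩ := hQp.exists_notMem (Y := Q ⊔ Submodule.span K {u}) (by
    intro hc
    have := Submodule.finrank_mono hc
    rw [hN.2] at this
    omega)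
  have huN : u ∈ Q ⊔ Submodule.span K {u} :=
    Submodule.mem_sup_right (Submodule.mem_span_singleton_self u)
  have hB : QuadraticMap.polar q v u ≠ 0 := by
    intro hB
    apply hvN
    rw [← hE.perp_eq hN, perp_sup]
    refine ⟨hv, mem_perp.2 fun x hx => ?_⟩
    obtain ⟨c, rfl⟩ := Submodule.mem_span_singleton.1 hx
    rw [QuadraticMap.polar_smul_left, QuadraticMap.polar_comm, hB, smul_zero]
  -- As `q u = 0`, this solves `q(v + c u) = q v + c B(v, u) = 0`, and `c ∈ K₀` because `u` and `v`
  -- are rational.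
  set c := - (q v / QuadraticMap.polar q v u) with hc
  have hcr : c ∈ K₀ := by
    refine K₀.neg_mem (K₀.div_mem ?_ ?_)
    · rw [hE v]
      exact K₀.sum_mem fun i _ => K₀.mul_mem (hvr _) (hvr _)
    · rw [hE.polar_eq]
      exact K₀.sum_mem fun i _ => K₀.add_mem (K₀.mul_mem (hvr _) (hur _))
        (K₀.mul_mem (hvr _) (hur _))
  have hqw : q (v + c • u) = 0 := by
    have : QuadraticMap.polar q v (c • u) = c * QuadraticMap.polar q v u := by
      rw [QuadraticMap.polar_smul_right, smul_eq_mul]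
    rw [QuadraticMap.polar, QuadraticMap.map_smul, hM.1 u hu.1] at this
    have h2 : c * QuadraticMap.polar q v u = - q v := by
      rw [hc]; field_simp
    rw [h2] at this
    simpa [sub_eq_iff_eq_add] using this
  have hwN : v + c • u ∉ Q ⊔ Submodule.span K {u} := fun h => hvN (by
    simpa using Submodule.sub_mem _ h (Submodule.smul_mem _ c huN))
  have hwr : IsRationalVector E K₀ (v + c • u) := fun i => by
    simpa using K₀.add_mem (hvr i) (K₀.mul_mem hcr (hur i))
  have hN' := hE.isGenerator_sup_span_singleton hQs hQn
    (Submodule.add_mem _ hv (Submodule.smul_mem _ c hu.2)) (fun h => hwN (le_sup_left (a := Q) h))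
    hqw
  rcases hE.eq_or_eq hN hN' hZ hQn le_sup_left le_sup_left hQZ (fun e => hwN (by
    rw [e]; exact Submodule.mem_sup_right (Submodule.mem_span_singleton_self _))) with e | e
  · exact absurd e hZN
  · rw [e]; exact hstab hwr

end IsCanonicalExpression

end Singular

/-! ### Type `D_n` -/

section TypeD

open Module

variable {K : Type u} [Field K] {V : Type v} [AddCommGroup V] [Module K V] {n : ℕ}
  {q : QuadraticForm K V} {E : Basis (Fin n × Fin 2) K V} {M₀ : Submodule K V} {K₀ : Subfield K}

theorem ElemD.finrank_of_dim {X : ElemD n q M₀} {i : ℕ} (h : X.type = .dim i) :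
    finrank K X.space = i := by
  have := X.hasType
  rw [h] at this
  exact this.2.2.2

theorem ElemD.isGenerator {X : ElemD n q M₀} (h : X.type = .plus ∨ X.type = .minus) :
    IsGenerator n q X.space := by
  have := X.hasType
  rcases h with h | h <;> rw [h] at this <;> exact this.1

theorem ElemD.ext' {X Y : ElemD n q M₀} (h : X.space = Y.space) (ht : X.type = Y.type) :
    X = Y := by
  cases X; cases Y; cases h; cases ht; rfl

theorem ElemD.le_of_inc [FiniteDimensional K V] {X Y : ElemD n q M₀}
    (h : (geomD n q M₀).Inc X Y) (hd : finrank K X.space < finrank K Y.space) :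
    X.space ≤ Y.space := by
  obtain ⟨X, s, hX⟩ := X
  obtain ⟨Y, t, hY⟩ := Y
  change IncD n X Y s t at h
  change finrank K X < finrank K Y at hd
  cases s <;> cases t <;> first
    | exact le_of_symm_le h hd.le
    | (have h1 := hX.1.2; have h2 := hY.1.2; omega)

theorem geomD_incInjective [FiniteDimensional K V] : (geomD n q M₀).IncInjective := by
  rintro ⟨X, s, hX⟩ ⟨Y, t, hY⟩ h (rfl : s = t)
  change IncD n X Y s s at h
  refine ElemD.ext' ?_ rfl
  change X = Y
  have hd : finrank K X = finrank K Y := by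
    cases s
    · exact hX.2.2.2.trans hY.2.2.2.symm
    · exact hX.1.2.trans hY.1.2.symm
    · exact hX.1.2.trans hY.1.2.symm
  have h' : X ≤ Y ∨ Y ≤ X := by cases s <;> exact h
  exact (le_of_symm_le h' hd.le).antisymm (le_of_symm_le h'.symm hd.ge)

theorem geomD_le_of_mem [FiniteDimensional K V] {F : Set (geomD n q M₀).Elem}
    (hF : (geomD n q M₀).IsFlag F) {X Y : ElemD n q M₀} (hX : X ∈ F) (hY : Y ∈ F)
    (h : finrank K X.space < finrank K Y.space) : X.space ≤ Y.space :=
  ElemD.le_of_inc (hF hX hY fun e => h.ne (by rw [e])) h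

theorem geomD_finrank_inf {F : Set (geomD n q M₀).Elem}
    (hF : (geomD n q M₀).IsFlag F) {X Y : ElemD n q M₀} (hX : X ∈ F) (hY : Y ∈ F)
    (hXt : X.type = .plus) (hYt : Y.type = .minus) :
    finrank K (X.space ⊓ Y.space : Submodule K V) + 1 = n := by
  have : IncD n X.space Y.space X.type Y.type := hF hX hY fun e => by
    rw [e, hYt] at hXt; cases hXt
  rwa [hXt, hYt] at this

/-- Generators of one family cannot meet in codimension one, so distinct ones sharing an
`(n-2)`-space meet exactly there. -/
theorem IsCanonicalExpression.inf_eq_of_type_eq (hE : IsCanonicalExpression q E)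
    (hM₀ : IsGenerator n q M₀) {X Y : ElemD n q M₀} (hX : X.type = .plus ∨ X.type = .minus)
    (hXY : X.type = Y.type) (hne : X.space ≠ Y.space) {W : Submodule K V} (hWX : W ≤ X.space)
    (hWY : W ≤ Y.space) (hW : finrank K W + 2 = n) : X.space ⊓ Y.space = W := by
  have := E.finiteDimensional_of_finite
  have hXg := X.isGenerator hX
  have hYg := Y.isGenerator (hXY ▸ hX)
  have hpar := hE.sameFamily_iff_not hM₀ hXg hYg
  have hne1 : finrank K (X.space ⊓ Y.space : Submodule K V) + 1 ≠ n := by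
    intro h
    have h := hpar h
    have h1 := X.hasType
    have h2 := Y.hasType
    rcases hX with hX | hX <;> rw [← hXY, hX] at h2 <;> rw [hX] at h1 <;>
      have h1 := h1.2 <;> have h2 := h2.2 <;> tauto
  have hlt : X.space ⊓ Y.space < X.space := lt_of_le_of_ne inf_le_left fun e =>
    hne (Submodule.eq_of_le_of_finrank_eq (inf_eq_left.1 e) (hXg.2.trans hYg.2.symm))
  have hlt := Submodule.finrank_lt_finrank_of_lt hlt
  rw [hXg.2] at hlt
  exact (Submodule.eq_of_le_of_finrank_le (le_inf hWX hWY) (by omega)).symm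

/-- The flags with a stable subspace between the elements of types `1` and `-`. -/
def stableFlagsD (E : Basis (Fin n × Fin 2) K V) (K₀ : Subfield K) (q : QuadraticForm K V)
    (M₀ : Submodule K V) (J : Set TypeD) : Set ((geomD n q M₀).grassmannian J).Point :=
  {F | ∃ N, IsStable E K₀ N ∧ ∀ P ∈ F.1, ∀ X ∈ F.1, ElemD.type P = .dim 1 →
    ElemD.type X = .minus → P.space ≤ N ∧ N ≤ X.space}

theorem IsCanonicalExpression.isSubspace_stableFlagsD (hE : IsCanonicalExpression q E)
    (hM₀ : IsGenerator n q M₀) (hn : 4 ≤ n) (K₀ : Subfield K) {J : Set TypeD}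
    (h1 : .dim 1 ∈ J) (hm : .minus ∈ J) (hJ : J ⊆ {.dim 1, .plus, .minus}) :
    ((geomD n q M₀).grassmannian J).IsSubspace (stableFlagsD E K₀ q M₀ J) := by
  have := E.finiteDimensional_of_finite
  have hD := geomD_incInjective (n := n) (q := q) (M₀ := M₀)
  rintro ⟨L, j, hj, hL⟩ ⟨F, hF⟩ ⟨N, hN, hNF⟩ ⟨F', hF'⟩ ⟨N', hN', hNF'⟩ hne hFL hFL' ⟨G, hG⟩ hGL
  change (geomD n q M₀).IsFlag (F ∪ L) at hFL
  change (geomD n q M₀).IsFlag (F' ∪ L) at hFL'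
  change (geomD n q M₀).IsFlag (G ∪ L) at hGL
  replace hne : F ≠ F' := fun h => hne (Subtype.ext h)
  obtain ⟨P, hP, hPt⟩ := hF.exists_mem h1
  obtain ⟨P', hP', hPt'⟩ := hF'.exists_mem h1
  obtain ⟨X, hX, hXt⟩ := hF.exists_mem hm
  obtain ⟨X', hX', hXt'⟩ := hF'.exists_mem hm
  have hNPX := hNF P hP X hX hPt hXt
  have hNPX' := hNF' P' hP' X' hX' hPt' hXt'
  have hPd := ElemD.finrank_of_dim hPt
  have hPd' := ElemD.finrank_of_dim hPt'
  have hXd := ElemD.isGenerator (.inr hXt)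
  have hXd' := ElemD.isGenerator (.inr hXt')
  rcases hJ hj with rfl | rfl | rfl
  · obtain ⟨M, hM, hMt⟩ := hL.exists_mem (t := .dim 2) (.inr (by
      simp [DiagramGeometry.fr, geomD, diagramD, edgeD]; omega))
    obtain ⟨Z, hZ, hZt⟩ := hL.exists_mem (t := .minus) (.inl ⟨hm, by simp⟩)
    have hMd := ElemD.finrank_of_dim hMt
    have hPP : P.space ≠ P'.space := fun e => hne (hD.eq_of_line hF hF' hL hFL hFL' hP
      (by rwa [ElemD.ext' e (hPt.trans hPt'.symm)]) hPt)
    have e1 : X = Z := hD.eq_of_mem hFL (.inl hX) (.inr hZ) (hXt.trans hZt.symm)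
    have e2 : X' = Z := hD.eq_of_mem hFL' (.inl hX') (.inr hZ) (hXt'.trans hZt.symm)
    have e3 : P.space ⊔ P'.space = M.space := sup_eq_of_finrank_le
      (geomD_le_of_mem hFL (.inl hP) (.inr hM) (by omega))
      (geomD_le_of_mem hFL' (.inl hP') (.inr hM) (by omega)) (by omega) hPP (by omega)
    refine ⟨N ⊔ N', hN.sup hN', fun P'' hP'' X'' hX'' hPt'' hXt'' => ⟨?_, ?_⟩⟩
    · have hPd'' := ElemD.finrank_of_dim hPt''
      calc P''.space ≤ M.space := geomD_le_of_mem hGL (.inl hP'') (.inr hM) (by omega)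
        _ = P.space ⊔ P'.space := e3.symm
        _ ≤ N ⊔ N' := sup_le_sup hNPX.1 hNPX'.1
    · have e4 : X'' = Z := hD.eq_of_mem hGL (.inl hX'') (.inr hZ) (hXt''.trans hZt.symm)
      rw [e4]
      exact sup_le (e1 ▸ hNPX.2) (e2 ▸ hNPX'.2)
  -- Only the element of type `+` varies on such a line, and the condition ignores it.
  · obtain ⟨Q, hQ, hQt⟩ := hL.exists_mem (t := .dim 1) (.inl ⟨h1, by simp⟩)
    obtain ⟨Z, hZ, hZt⟩ := hL.exists_mem (t := .minus) (.inl ⟨hm, by simp⟩)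
    refine ⟨N, hN, fun P'' hP'' X'' hX'' hPt'' hXt'' => ?_⟩
    have e1 : P = Q := hD.eq_of_mem hFL (.inl hP) (.inr hQ) (hPt.trans hQt.symm)
    have e2 : X = Z := hD.eq_of_mem hFL (.inl hX) (.inr hZ) (hXt.trans hZt.symm)
    have e3 : P'' = Q := hD.eq_of_mem hGL (.inl hP'') (.inr hQ) (hPt''.trans hQt.symm)
    have e4 : X'' = Z := hD.eq_of_mem hGL (.inl hX'') (.inr hZ) (hXt''.trans hZt.symm)
    rw [e3, e4, ← e1, ← e2]
    exact hNPX
  · obtain ⟨W, hW, hWt⟩ := hL.exists_mem (t := .dim (n - 2)) (.inr (by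
      simp [DiagramGeometry.fr, geomD, diagramD, edgeD]; omega))
    obtain ⟨Q, hQ, hQt⟩ := hL.exists_mem (t := .dim 1) (.inl ⟨h1, by simp⟩)
    have hWd := ElemD.finrank_of_dim hWt
    have hXX : X.space ≠ X'.space := fun e => hne (hD.eq_of_line hF hF' hL hFL hFL' hX
      (by rwa [ElemD.ext' e (hXt.trans hXt'.symm)]) hXt)
    have e1 : P = Q := hD.eq_of_mem hFL (.inl hP) (.inr hQ) (hPt.trans hQt.symm)
    have e2 : P' = Q := hD.eq_of_mem hFL' (.inl hP') (.inr hQ) (hPt'.trans hQt.symm)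
    have e3 : X.space ⊓ X'.space = W.space := hE.inf_eq_of_type_eq hM₀ (.inr hXt)
      (hXt.trans hXt'.symm) hXX
      (geomD_le_of_mem hFL (.inr hW) (.inl hX) (by rw [hXd.2]; omega))
      (geomD_le_of_mem hFL' (.inr hW) (.inl hX') (by rw [hXd'.2]; omega)) (by omega)
    refine ⟨N ⊓ N', hN.inf hN', fun P'' hP'' X'' hX'' hPt'' hXt'' => ⟨?_, ?_⟩⟩
    · have e4 : P'' = Q := hD.eq_of_mem hGL (.inl hP'') (.inr hQ) (hPt''.trans hQt.symm)
      rw [e4]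
      exact le_inf (e1 ▸ hNPX.1) (e2 ▸ hNPX'.1)
    · calc N ⊓ N' ≤ X.space ⊓ X'.space := inf_le_inf hNPX.2 hNPX'.2
        _ = W.space := e3
        _ ≤ X''.space := geomD_le_of_mem hGL (.inr hW) (.inl hX'')
          (by rw [(ElemD.isGenerator (.inr hXt'')).2]; omega)

/-- One of the generators `X`, `Y` is stable, or a stable subspace of dimension `n - 2` is contained
in both of them. -/
def StablyJoined (E : Basis (Fin n × Fin 2) K V) (K₀ : Subfield K) (X Y : Submodule K V) : Prop :=
  IsStable E K₀ X ∨ IsStable E K₀ Y ∨ ∃ N, IsStable E K₀ N ∧ N ≤ X ∧ N ≤ Y ∧ finrank K N + 2 = n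

theorem StablyJoined.symm {X Y : Submodule K V} (h : StablyJoined E K₀ X Y) :
    StablyJoined E K₀ Y X := by
  rcases h with h | h | ⟨N, h, hX, hY, hN⟩
  exacts [.inr (.inl h), .inl h, .inr (.inr ⟨N, h, hY, hX, hN⟩)]

/-- `Z` is the generator fixed along a line and `W` the `(n-2)`-space of the line. Either conclusion
makes every point of the line stably joined, since each of its generators contains `W`. -/
theorem IsCanonicalExpression.isStable_or_isStable (hE : IsCanonicalExpression q E)
    {X X' Z W : Submodule K V} (hX : IsGenerator n q X) (hX' : IsGenerator n q X')
    (hZ : IsGenerator n q Z) (hXX' : X ⊓ X' = W) (hW : finrank K W + 2 = n)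
    (hXZ : finrank K (X ⊓ Z : Submodule K V) + 1 = n)
    (hXZ' : finrank K (X' ⊓ Z : Submodule K V) + 1 = n)
    (h : StablyJoined E K₀ X Z) (h' : StablyJoined E K₀ X' Z) :
    IsStable E K₀ Z ∨ IsStable E K₀ W := by
  have := E.finiteDimensional_of_finite
  have mixed : ∀ {A A' N : Submodule K V}, IsGenerator n q A → A ⊓ A' = W →
      finrank K (A ⊓ Z : Submodule K V) + 1 = n → IsStable E K₀ A → IsStable E K₀ N → N ≤ A' →
      N ≤ Z → finrank K N + 2 = n → IsStable E K₀ Z ∨ IsStable E K₀ W := by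
    intro A A' N hA hAA hAZ hAs hNs hNA hNZ hNn
    by_cases hNA' : N ≤ A
    · right
      rwa [← Submodule.eq_of_le_of_finrank_eq (hAA ▸ le_inf hNA' hNA : N ≤ W) (by omega)]
    · left
      -- If `N` is not in `A = A⊥`, then `A ∩ N⊥` is a proper subspace of `A` containing the
      -- hyperplane `A ∩ Z`. So `A ∩ Z = A ∩ N⊥` is stable, and it is a hyperplane of `Z`.
      have hlt : A ⊓ perp q N < A := lt_of_le_of_ne inf_le_left fun e =>
        hNA' (by rw [← hE.perp_eq hA]; exact le_perp_comm.1 (inf_eq_left.1 e))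
      have hlt := Submodule.finrank_lt_finrank_of_lt hlt
      rw [hA.2] at hlt
      have e : A ⊓ Z = A ⊓ perp q N := Submodule.eq_of_le_of_finrank_le
        (inf_le_inf_left _ (hZ.1.le_perp.trans (perp_anti hNZ))) (by omega)
      exact hE.isStable_of_hyperplane hZ (e ▸ hAs.inf (hE.isStable_perp hNs)) hAZ inf_le_right
  rcases h with h | h | ⟨N, hN, hNX, hNZ, hNn⟩
  · rcases h' with h' | h' | ⟨N', hN', hNX', hNZ', hNn'⟩
    · exact .inr (hXX' ▸ h.inf h')
    · exact .inl h'
    · exact mixed hX hXX' hXZ h hN' hNX' hNZ' hNn'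
  · exact .inl h
  · rcases h' with h' | h' | ⟨N', hN', hNX', hNZ', hNn'⟩
    · exact mixed hX' (inf_comm X' X ▸ hXX') hXZ' h' hN hNX hNZ hNn
    · exact .inl h'
    · by_cases e : N = N'
      · right
        subst e
        rwa [← Submodule.eq_of_le_of_finrank_eq (hXX' ▸ le_inf hNX hNX' : N ≤ W) (by omega)]
      · left
        -- Two distinct stable `(n-2)`-spaces in `Z` span a hyperplane of `Z` or all of it.
        have hlt : N < N ⊔ N' := lt_of_le_of_ne le_sup_left fun e' =>
          e (Submodule.eq_of_le_of_finrank_eq (sup_eq_left.1 e'.symm) (by omega)).symm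
        have hlt := Submodule.finrank_lt_finrank_of_lt hlt
        have hle : N ⊔ N' ≤ Z := sup_le hNZ hNZ'
        have hle' := Submodule.finrank_mono hle
        rw [hZ.2] at hle'
        by_cases h1 : finrank K (N ⊔ N' : Submodule K V) + 1 = n
        · exact hE.isStable_of_hyperplane hZ (hN.sup hN') h1 hle
        · rw [← Submodule.eq_of_le_of_finrank_le hle (by rw [hZ.2]; omega)]
          exact hN.sup hN'

/-- The flags whose elements of types `+` and `-` are stably joined. -/
def stablyJoinedFlags (E : Basis (Fin n × Fin 2) K V) (K₀ : Subfield K) (q : QuadraticForm K V)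
    (M₀ : Submodule K V) (J : Set TypeD) : Set ((geomD n q M₀).grassmannian J).Point :=
  {F | ∀ X ∈ F.1, ∀ Y ∈ F.1, ElemD.type X = .plus → ElemD.type Y = .minus →
    StablyJoined E K₀ X.space Y.space}

theorem IsCanonicalExpression.isSubspace_stablyJoinedFlags (hE : IsCanonicalExpression q E)
    (hM₀ : IsGenerator n q M₀) (hn : 3 ≤ n) (K₀ : Subfield K) :
    ((geomD n q M₀).grassmannian {.plus, .minus}).IsSubspace
      (stablyJoinedFlags E K₀ q M₀ {.plus, .minus}) := by
  have := E.finiteDimensional_of_finite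
  have hD := geomD_incInjective (n := n) (q := q) (M₀ := M₀)
  rintro ⟨L, j, hj, hL⟩ ⟨F, hF⟩ hSF ⟨F', hF'⟩ hSF' hne hFL hFL' ⟨G, hG⟩ hGL X'' hX'' Y'' hY''
    hXt'' hYt''
  change (geomD n q M₀).IsFlag (F ∪ L) at hFL
  change (geomD n q M₀).IsFlag (F' ∪ L) at hFL'
  change (geomD n q M₀).IsFlag (G ∪ L) at hGL
  replace hne : F ≠ F' := fun h => hne (Subtype.ext h)
  obtain ⟨X, hX, hXt⟩ := hF.exists_mem (t := .plus) (by simp)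
  obtain ⟨X', hX', hXt'⟩ := hF'.exists_mem (t := .plus) (by simp)
  obtain ⟨Y, hY, hYt⟩ := hF.exists_mem (t := .minus) (by simp)
  obtain ⟨Y', hY', hYt'⟩ := hF'.exists_mem (t := .minus) (by simp)
  have hS := hSF X hX Y hY hXt hYt
  have hS' := hSF' X' hX' Y' hY' hXt' hYt'
  have hXg := ElemD.isGenerator (.inl hXt)
  have hXg' := ElemD.isGenerator (.inl hXt')
  have hXg'' := ElemD.isGenerator (.inl hXt'')
  have hYg := ElemD.isGenerator (.inr hYt)
  have hYg' := ElemD.isGenerator (.inr hYt')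
  have hYg'' := ElemD.isGenerator (.inr hYt'')
  have hd := geomD_finrank_inf hF.1 hX hY hXt hYt
  have hd' := geomD_finrank_inf hF'.1 hX' hY' hXt' hYt'
  have hWex : ∃ W ∈ L, (geomD n q M₀).typ W = .dim (n - 2) := by
    rcases hj with rfl | rfl <;> refine hL.exists_mem (.inr ?_) <;>
      simp [DiagramGeometry.fr, geomD, diagramD, edgeD] <;> omega
  obtain ⟨W, hW, hWt⟩ := hWex
  have hWd := ElemD.finrank_of_dim hWt
  have hle {A : Set (ElemD n q M₀)} (hA : (geomD n q M₀).IsFlag (A ∪ L)) {Z : ElemD n q M₀}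
      (hZ : Z ∈ A) (hZg : IsGenerator n q Z.space) : W.space ≤ Z.space :=
    geomD_le_of_mem hA (.inr hW) (.inl hZ) (by rw [hZg.2]; omega)
  have hWX := hle hFL hX hXg
  have hWX' := hle hFL' hX' hXg'
  have hWX'' := hle hGL hX'' hXg''
  have hWY := hle hFL hY hYg
  have hWY' := hle hFL' hY' hYg'
  have hWY'' := hle hGL hY'' hYg''
  rcases hj with rfl | rfl
  · obtain ⟨Z, hZ, hZt⟩ := hL.exists_mem (t := .minus) (.inl ⟨by simp, by simp⟩)
    have e1 : Y = Z := hD.eq_of_mem hFL (.inl hY) (.inr hZ) (hYt.trans hZt.symm)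
    have e2 : Y' = Z := hD.eq_of_mem hFL' (.inl hY') (.inr hZ) (hYt'.trans hZt.symm)
    have e3 : Y'' = Z := hD.eq_of_mem hGL (.inl hY'') (.inr hZ) (hYt''.trans hZt.symm)
    have hXX : X.space ≠ X'.space := fun e => hne (hD.eq_of_line hF hF' hL hFL hFL' hX
      (by rwa [ElemD.ext' e (hXt.trans hXt'.symm)]) hXt)
    have hinf := hE.inf_eq_of_type_eq hM₀ (.inl hXt) (hXt.trans hXt'.symm) hXX hWX hWX' (by omega)
    rcases hE.isStable_or_isStable hXg hXg' hYg hinf (by omega) hd (by rwa [e1, ← e2]) hS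
      (by rwa [e1, ← e2]) with h | h
    · exact .inr (.inl (by rwa [e3, ← e1]))
    · exact .inr (.inr ⟨_, h, hWX'', hWY'', by omega⟩)
  · obtain ⟨Z, hZ, hZt⟩ := hL.exists_mem (t := .plus) (.inl ⟨by simp, by simp⟩)
    have e1 : X = Z := hD.eq_of_mem hFL (.inl hX) (.inr hZ) (hXt.trans hZt.symm)
    have e2 : X' = Z := hD.eq_of_mem hFL' (.inl hX') (.inr hZ) (hXt'.trans hZt.symm)
    have e3 : X'' = Z := hD.eq_of_mem hGL (.inl hX'') (.inr hZ) (hXt''.trans hZt.symm)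
    have hYY : Y.space ≠ Y'.space := fun e => hne (hD.eq_of_line hF hF' hL hFL hFL' hY
      (by rwa [ElemD.ext' e (hYt.trans hYt'.symm)]) hYt)
    have hinf := hE.inf_eq_of_type_eq hM₀ (.inr hYt) (hYt.trans hYt'.symm) hYY hWY hWY' (by omega)
    rw [inf_comm] at hd hd'
    rcases hE.isStable_or_isStable hYg hYg' hXg hinf (by omega) hd (by rwa [e1, ← e2]) hS.symm
      (by rw [e1, ← e2]; exact hS'.symm) with h | h
    · exact .inl (by rwa [e3, ← e1])
    · exact .inr (.inr ⟨_, h, hWX'', hWY'', by omega⟩)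

/-! ### Two generators in general position with respect to the rational subspaces -/

/-- At most `n` independent equations leave dimension at least `n`, and total singularity bounds it
by `n`. -/
theorem IsCanonicalExpression.isGenerator_ker (hE : IsCanonicalExpression q E)
    (f : V →ₗ[K] Fin n → K) (hf : IsTotallySingular q (LinearMap.ker f)) :
    IsGenerator n q (LinearMap.ker f) := by
  have := E.finiteDimensional_of_finite
  refine ⟨hf, (hE.finrank_le hf).antisymm ?_⟩
  have h := LinearMap.finrank_range_add_finrank_ker f
  have h' := Submodule.finrank_le (LinearMap.range f)
  rw [finrank_hyperbolic E] at h
  simp only [finrank_fintype_fun_eq_card, Fintype.card_fin] at h'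
  omega

theorem IsCanonicalExpression.exists_generators (hE : IsCanonicalExpression q E) (hn : 3 ≤ n)
    {a : K} (ha : a ∉ K₀) : ∃ (X Y : Submodule K V) (u : V), u ≠ 0 ∧ u ∈ X ∧ u ∈ Y ∧
      IsGenerator n q X ∧ IsGenerator n q Y ∧ finrank K (X ⊓ Y : Submodule K V) + 1 = n ∧
      (∀ N, IsStable E K₀ N → u ∈ N → ¬ N ≤ X ∧ ¬ N ≤ Y) ∧
      ∀ N, IsStable E K₀ N → N ≤ X → N ≤ Y → finrank K N + 2 ≠ n := by
  classical
  have := E.finiteDimensional_of_finite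
  have ha0 : a ≠ 0 := fun h => ha (h ▸ K₀.zero_mem)
  obtain ⟨φ, hφ, h1, h2⟩ := exists_addMonoidHom ha
  obtain ⟨i₀, hi₀⟩ : ∃ i : Fin n, i.val = 0 := ⟨⟨0, by omega⟩, rfl⟩
  obtain ⟨i₁, hi₁⟩ : ∃ i : Fin n, i.val = 1 := ⟨⟨1, by omega⟩, rfl⟩
  obtain ⟨i₂, hi₂⟩ : ∃ i : Fin n, i.val = 2 := ⟨⟨2, by omega⟩, rfl⟩
  have h01 : i₀ ≠ i₁ := fun h => by rw [h] at hi₀; omega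
  have h02 : i₀ ≠ i₂ := fun h => by rw [h] at hi₀; omega
  have h12 : i₁ ≠ i₂ := fun h => by rw [h] at hi₁; omega
  have hq (x : V) (hx : ∀ i, i ≠ i₀ → i ≠ i₁ → i ≠ i₂ → E.repr x (i, 1) = 0) :
      q x = E.repr x (i₀, 0) * E.repr x (i₀, 1) + E.repr x (i₁, 0) * E.repr x (i₁, 1) +
        E.repr x (i₂, 0) * E.repr x (i₂, 1) := by
    rw [hE x, ← Finset.sum_subset (Finset.subset_univ {i₀, i₁, i₂}), Finset.sum_insert
      (by simp [h01, h02]), Finset.sum_pair h12, add_assoc]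
    intro i _ hi
    simp only [Finset.mem_insert, Finset.mem_singleton, not_or] at hi
    rw [hx i hi.1 hi.2.1 hi.2.2, mul_zero]
  -- Write `xᵢ, yᵢ` for the coordinates `(i, 0), (i, 1)`. `ker f` is `x₁ = a x₀`, `y₀ = -a y₁`, `yᵢ
  -- = 0` for `i ≥ 2`. `ker g` modifies this to `x₁ = a (x₀ - y₂)`, `x₂ = a y₁`, still totally
  -- singular. The extra equation `x₂ = a y₁` leaves room in the intersection only for stable
  -- subspaces of dimension at most `n - 3`.
  let f : V →ₗ[K] Fin n → K := LinearMap.pi fun i =>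
    if i = i₀ then E.coord (i₁, 0) - a • E.coord (i₀, 0)
    else if i = i₁ then E.coord (i₀, 1) + a • E.coord (i₁, 1)
    else E.coord (i, 1)
  let g : V →ₗ[K] Fin n → K := LinearMap.pi fun i =>
    if i = i₀ then E.coord (i₁, 0) - a • (E.coord (i₀, 0) - E.coord (i₂, 1))
    else if i = i₁ then E.coord (i₀, 1) + a • E.coord (i₁, 1)
    else if i = i₂ then E.coord (i₂, 0) - a • E.coord (i₁, 1)
    else E.coord (i, 1)
  have hf (x : V) : x ∈ LinearMap.ker f ↔ E.repr x (i₁, 0) = a * E.repr x (i₀, 0) ∧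
      E.repr x (i₀, 1) = - (a * E.repr x (i₁, 1)) ∧
      ∀ i, i ≠ i₀ → i ≠ i₁ → E.repr x (i, 1) = 0 := by
    rw [LinearMap.mem_ker, funext_iff]
    constructor
    · intro h
      refine ⟨?_, ?_, fun i hi hi' => ?_⟩
      · simpa [f, sub_eq_zero] using h i₀
      · simpa [f, h01.symm, add_eq_zero_iff_eq_neg] using h i₁
      · simpa [f, hi, hi'] using h i
    · rintro ⟨h, h', h''⟩ i
      by_cases hi : i = i₀
      · simp [f, hi, h]
      by_cases hi' : i = i₁
      · simp [f, hi', h01.symm, h']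
      · simp [f, hi, hi', h'']
  have hg (x : V) : x ∈ LinearMap.ker g ↔
      E.repr x (i₁, 0) = a * (E.repr x (i₀, 0) - E.repr x (i₂, 1)) ∧
      E.repr x (i₀, 1) = - (a * E.repr x (i₁, 1)) ∧ E.repr x (i₂, 0) = a * E.repr x (i₁, 1) ∧
      ∀ i, i ≠ i₀ → i ≠ i₁ → i ≠ i₂ → E.repr x (i, 1) = 0 := by
    rw [LinearMap.mem_ker, funext_iff]
    constructor
    · intro h
      refine ⟨?_, ?_, ?_, fun i hi hi' hi'' => ?_⟩
      · simpa [g, sub_eq_zero] using h i₀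
      · simpa [g, h01.symm, add_eq_zero_iff_eq_neg] using h i₁
      · simpa [g, h02.symm, h12.symm, sub_eq_zero] using h i₂
      · simpa [g, hi, hi', hi''] using h i
    · rintro ⟨h, h', h'', h'''⟩ i
      by_cases hi : i = i₀
      · simp [g, hi, h]
      by_cases hi' : i = i₁
      · simp [g, hi', h01.symm, h']
      by_cases hi'' : i = i₂
      · simp [g, hi'', h02.symm, h12.symm, h'']
      · simp [g, hi, hi', hi'', h''']
  have hXg : IsGenerator n q (LinearMap.ker f) := hE.isGenerator_ker f fun x hx => by
    obtain ⟨h, h', h''⟩ := (hf x).1 hx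
    rw [hq x fun i hi hi' _ => h'' i hi hi', h, h', h'' i₂ h02.symm h12.symm]
    ring
  have hYg : IsGenerator n q (LinearMap.ker g) := hE.isGenerator_ker g fun x hx => by
    obtain ⟨h, h', h'', h'''⟩ := (hg x).1 hx
    rw [hq x h''', h, h', h'']
    ring
  have hinf : LinearMap.ker f ⊓ LinearMap.ker g =
      LinearMap.ker g ⊓ LinearMap.ker (E.coord (i₂, 1)) := by
    ext x
    rw [Submodule.mem_inf, Submodule.mem_inf, hf, hg, LinearMap.mem_ker, Basis.coord_apply]
    constructor
    · rintro ⟨⟨-, -, h⟩, h'⟩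
      exact ⟨h', h i₂ h02.symm h12.symm⟩
    · rintro ⟨⟨h, h', h'', h'''⟩, h4⟩
      refine ⟨⟨by simpa [h4] using h, h', fun i hi hi' => ?_⟩, h, h', h'', h'''⟩
      by_cases hi'' : i = i₂
      · rwa [hi'']
      · exact h''' i hi hi' hi''
  have hdim : finrank K (LinearMap.ker f ⊓ LinearMap.ker g : Submodule K V) + 1 = n := by
    rw [hinf]
    have hlt : LinearMap.ker g ⊓ LinearMap.ker (E.coord (i₂, 1)) < LinearMap.ker g := by
      refine lt_of_le_of_ne inf_le_left fun e => ?_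
      have hw : E (i₂, 1) + E (i₀, 0) ∈ LinearMap.ker g := by
        rw [hg]
        refine ⟨?_, ?_, ?_, fun i hi hi' hi'' => ?_⟩ <;>
          simp [h02.symm, *, Ne.symm]
      have := inf_eq_left.1 e hw
      simp [LinearMap.mem_ker] at this
    have hlt := Submodule.finrank_lt_finrank_of_lt hlt
    have h3 := Submodule.finrank_sup_add_finrank_inf_eq (LinearMap.ker g)
      (LinearMap.ker (E.coord (i₂, 1)))
    have h4 := Submodule.finrank_le (LinearMap.ker g ⊔ LinearMap.ker (E.coord (i₂, 1)))
    have h5 := Module.Dual.finrank_ker_add_one_of_ne_zero (f := E.coord (i₂, 1)) fun h => by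
      have := congrArg (fun l => l (E (i₂, 1))) h
      simp at this
    rw [finrank_hyperbolic E] at h4 h5
    rw [hYg.2] at h3 hlt
    omega
  let u : V := E (i₀, 0) + a • E (i₁, 0)
  have hφu : coordwise E φ u = φ 1 • E (i₀, 0) := by
    apply E.ext_elem
    rintro ⟨i, j⟩
    rw [repr_coordwise]
    by_cases hj : j = 0
    · subst hj
      by_cases h0 : i = i₀
      · subst h0; simp [u, h01.symm]
      · by_cases h1 : i = i₁
        · subst h1; simp [u, h01, h2]
        · simp [u, Ne.symm h0, Ne.symm h1]
    · simp [u, Ne.symm hj]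
  refine ⟨LinearMap.ker f, LinearMap.ker g, u, ?_, ?_, ?_, hXg, hYg, hdim, ?_, ?_⟩
  · intro h
    have := congrArg (fun x => E.repr x (i₀, 0)) h
    simp [u, h01.symm] at this
  · simp [hf, u, h01, h01.symm]
  · simp [hg, u, h01, h01.symm, h02, h12]
  · intro N hN huN
    have hmem := hN φ hφ u huN
    rw [hφu] at hmem
    constructor <;> intro hle
    · have := ((hf _).1 (hle hmem)).1
      simp [h01, h1, ha0] at this
    · have := ((hg _).1 (hle hmem)).1
      simp [h01, h1, ha0] at this
  · intro N hN hNX hNY hNn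
    -- Scale to `x₀ = 1`, so `x₁ = a`. Applying `φ` gives `x₀ = φ 1 ≠ 0` and `x₁ = 0`, against `x₁ =
    -- a x₀`. The same works for `y₁` with `y₀ = -a y₁`.
    have hx0 (x : V) (hx : x ∈ N) : E.repr x (i₀, 0) = 0 := by
      by_contra hne
      have hy := N.smul_mem (E.repr x (i₀, 0))⁻¹ hx
      have e1 := ((hf _).1 (hNX hy)).1
      have e2 := ((hf _).1 (hNX (hN φ hφ _ hy))).1
      rw [repr_coordwise, repr_coordwise, e1] at e2
      simp [hne, h1, h2, ha0] at e2
    have hx1 (x : V) (hx : x ∈ N) : E.repr x (i₁, 1) = 0 := by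
      by_contra hne
      have hy := N.smul_mem (E.repr x (i₁, 1))⁻¹ hx
      have e1 := ((hf _).1 (hNX hy)).2.1
      have e2 := ((hf _).1 (hNX (hN φ hφ _ hy))).2.1
      rw [repr_coordwise, repr_coordwise, e1] at e2
      simp [hne, h1, h2, ha0] at e2
    -- On `N` all coordinates now vanish except `xᵢ` with `i ≥ 3`.
    let l : N →ₗ[K] Fin (n - 3) → K :=
      (LinearMap.pi fun i => E.coord (⟨i.val + 3, by omega⟩, 0)).comp N.subtype
    have hl : Function.Injective l := by
      rw [← LinearMap.ker_eq_bot, LinearMap.ker_eq_bot']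
      rintro ⟨x, hx⟩ hlx
      refine Subtype.ext (E.ext_elem ?_)
      obtain ⟨e1, e2, e3⟩ := (hf x).1 (hNX hx)
      obtain ⟨-, -, e4, -⟩ := (hg x).1 (hNY hx)
      rw [hx0 x hx, mul_zero] at e1
      rw [hx1 x hx, mul_zero] at e2 e4
      rw [neg_zero] at e2
      rintro ⟨i, j⟩
      suffices E.repr x (i, j) = 0 by simpa using this
      by_cases h0 : i = i₀
      · subst h0; fin_cases j
        exacts [hx0 x hx, e2]
      by_cases h1 : i = i₁
      · subst h1; fin_cases j
        exacts [e1, hx1 x hx]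
      fin_cases j
      · by_cases h2 : i = i₂
        · subst h2; exact e4
        · have h3 : 3 ≤ i.val := by
            have := fun h : i.val = 0 => h0 (Fin.ext (h.trans hi₀.symm))
            have := fun h : i.val = 1 => h1 (Fin.ext (h.trans hi₁.symm))
            have := fun h : i.val = 2 => h2 (Fin.ext (h.trans hi₂.symm))
            omega
          have := congrFun hlx ⟨i.val - 3, by omega⟩
          simpa [l, Nat.sub_add_cancel h3] using this
      · exact e3 i h0 h1
    have := LinearMap.finrank_le_finrank_of_injective hl
    simp only [finrank_fintype_fun_eq_card, Fintype.card_fin] at this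
    omega

/-- Which of the two generators has type `+` depends on `M₀`. The properties of the pair are
symmetric, so they may be swapped. -/
theorem IsCanonicalExpression.exists_elements (hE : IsCanonicalExpression q E) (hn : 3 ≤ n)
    (hM₀ : IsGenerator n q M₀) (hK : K₀ ≠ ⊤) : ∃ P X Y : ElemD n q M₀,
      P.type = .dim 1 ∧ X.type = .plus ∧ Y.type = .minus ∧ P.space ≤ X.space ∧
      P.space ≤ Y.space ∧ finrank K (X.space ⊓ Y.space : Submodule K V) + 1 = n ∧
      (∀ N, IsStable E K₀ N → P.space ≤ N → ¬ N ≤ Y.space) ∧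
      ¬ StablyJoined E K₀ X.space Y.space := by
  obtain ⟨a, ha⟩ : ∃ a, a ∉ K₀ := by
    by_contra! h
    exact hK (eq_top_iff.2 fun x _ => h x)
  obtain ⟨X, Y, u, hu, huX, huY, hX, hY, hXY, h1, h2⟩ := hE.exists_generators hn ha
  let P : ElemD n q M₀ := ⟨Submodule.span K {u}, .dim 1, le_rfl, hn,
    isTotallySingular_span_singleton (hX.1 u huX), finrank_span_singleton hu⟩
  have hJ : ¬ StablyJoined E K₀ X Y := by
    rintro (h | h | ⟨N, hN, hNX, hNY, hNn⟩)
    exacts [(h1 X h huX).1 le_rfl, (h1 Y h huY).2 le_rfl, h2 N hN hNX hNY hNn]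
  have hle {Z : Submodule K V} : P.space ≤ Z ↔ u ∈ Z := Submodule.span_singleton_le_iff_mem u Z
  have hpar := hE.sameFamily_iff_not hM₀ hX hY hXY
  by_cases hXp : SameFamily X M₀
  · exact ⟨P, ⟨X, .plus, hX, hXp⟩, ⟨Y, .minus, hY, hpar.1 hXp⟩, rfl, rfl, rfl, hle.2 huX,
      hle.2 huY, hXY, fun N hN h => (h1 N hN (hle.1 h)).2, hJ⟩
  · exact ⟨P, ⟨Y, .plus, hY, not_not.1 fun h => hXp (hpar.2 h)⟩, ⟨X, .minus, hX, hXp⟩, rfl, rfl,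
      rfl, hle.2 huY, hle.2 huX, inf_comm X Y ▸ hXY, fun N hN h => (h1 N hN (hle.1 h)).1,
      fun h => hJ h.symm⟩

/-! ### Non-generation for `D_n` -/

theorem IsCanonicalExpression.not_isGeneratedOverD_of_dim_one (hE : IsCanonicalExpression q E)
    (hM₀ : IsGenerator n q M₀) (hn : 4 ≤ n) {J : Set TypeD}
    (h1 : .dim 1 ∈ J) (hm : .minus ∈ J) (hJ : J ⊆ {.dim 1, .plus, .minus})
    {F : Set (geomD n q M₀).Elem} (hF : (geomD n q M₀).IsFlagOfType J F) {P Y : ElemD n q M₀}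
    (hP : P ∈ F) (hY : Y ∈ F) (hPt : P.type = .dim 1) (hYt : Y.type = .minus)
    (h : ∀ N, IsStable E K₀ N → P.space ≤ N → ¬ N ≤ Y.space) :
    ¬ IsGeneratedOverD q E M₀ J K₀ := by
  have := E.finiteDimensional_of_finite
  refine PointLineGeometry.not_generates (p := ⟨F, hF⟩)
    (hE.isSubspace_stableFlagsD hM₀ hn K₀ h1 hm hJ) ?_ ?_
  · rintro ⟨G, hG⟩ hrat
    obtain ⟨Q, hQ, hQt⟩ := hG.exists_mem h1
    refine ⟨Q.space, (hrat Q hQ).isStable, fun P' hP' X hX hPt' hXt => ?_⟩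
    have e : P' = Q := geomD_incInjective.eq_of_mem hG.1 hP' hQ (hPt'.trans hQt.symm)
    subst e
    refine ⟨le_rfl, geomD_le_of_mem hG.1 hP' hX ?_⟩
    rw [ElemD.finrank_of_dim hPt', (ElemD.isGenerator (.inr hXt)).2]
    omega
  · rintro ⟨N, hN, hNF⟩
    obtain ⟨h1, h2⟩ := hNF P hP Y hY hPt hYt
    exact h N hN h1 h2

theorem geomD_inc_of_le {X Y : ElemD n q M₀} {i : ℕ} (hX : X.type = .dim i)
    (h : X.space ≤ Y.space) : (geomD n q M₀).Inc X Y ∧ (geomD n q M₀).Inc Y X := by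
  obtain ⟨X, s, hX'⟩ := X
  obtain ⟨Y, t, hY'⟩ := Y
  cases hX
  cases t <;> exact ⟨.inl h, .inr h⟩

theorem geomD_inc_of_finrank {X Y : ElemD n q M₀} (hX : X.type = .plus) (hY : Y.type = .minus)
    (h : finrank K (X.space ⊓ Y.space : Submodule K V) + 1 = n) :
    (geomD n q M₀).Inc X Y ∧ (geomD n q M₀).Inc Y X := by
  obtain ⟨X, s, hX'⟩ := X
  obtain ⟨Y, t, hY'⟩ := Y
  cases hX
  cases hY
  exact ⟨h, by rw [inf_comm] at h; exact h⟩

theorem IsCanonicalExpression.not_isGeneratedOverD (hE : IsCanonicalExpression q E)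
    (hM₀ : IsGenerator n q M₀) (hn : 3 ≤ n) (hK : K₀ ≠ ⊤) :
    ¬ IsGeneratedOverD q E M₀ {.plus, .minus} K₀ ∧
    (4 ≤ n → ¬ IsGeneratedOverD q E M₀ {.dim 1, .plus, .minus} K₀) ∧
    (4 ≤ n → ¬ IsGeneratedOverD q E M₀ {.dim 1, .minus} K₀) := by
  obtain ⟨P, X, Y, hPt, hXt, hYt, hPX, hPY, hXY, hN, hJ⟩ := hE.exists_elements hn hM₀ hK
  let D := geomD n q M₀
  have hiPX := geomD_inc_of_le hPt hPX
  have hiPY := geomD_inc_of_le hPt hPY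
  have hiXY := geomD_inc_of_finrank hXt hYt hXY
  have hPt' : D.typ P = .dim 1 := hPt
  have hXt' : D.typ X = .plus := hXt
  have hYt' : D.typ Y = .minus := hYt
  have hF1 : D.IsFlagOfType {.plus, .minus} {X, Y} := by
    refine ⟨(Set.pairwise_pair (r := D.Inc)).2 fun _ => hiXY, ?_⟩
    refine (Set.image_pair D.typ X Y).trans ?_
    rw [hXt', hYt']
  have hF2 : D.IsFlagOfType {.dim 1, .minus} {P, Y} := by
    refine ⟨(Set.pairwise_pair (r := D.Inc)).2 fun _ => hiPY, ?_⟩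
    refine (Set.image_pair D.typ P Y).trans ?_
    rw [hPt', hYt']
  have hF3 : D.IsFlagOfType {.dim 1, .plus, .minus} (insert (P : D.Elem) {X, Y}) := by
    constructor
    · refine (Set.pairwise_insert (r := D.Inc)).2 ⟨hF1.1, ?_⟩
      rintro Z (rfl | rfl) _
      exacts [hiPX, hiPY]
    · refine (Set.image_insert_eq (f := D.typ) (a := P) (s := {X, Y})).trans ?_
      exact congrArg₂ insert hPt' hF1.2
  refine ⟨?_, fun hn => ?_, fun hn => ?_⟩
  · refine PointLineGeometry.not_generates (p := ⟨{X, Y}, hF1⟩)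
      (hE.isSubspace_stablyJoinedFlags hM₀ hn K₀) ?_ fun h => ?_
    · rintro ⟨G, hG⟩ hrat A hA B hB hAt hBt
      exact .inl (hrat A hA).isStable
    · exact hJ (h X (.inl rfl) Y (.inr rfl) hXt hYt)
  · exact hE.not_isGeneratedOverD_of_dim_one hM₀ hn (by simp) (by simp) subset_rfl hF3
      (.inl rfl) (.inr (.inr rfl)) hPt hYt hN
  · exact hE.not_isGeneratedOverD_of_dim_one hM₀ hn (by simp) (by simp)
      (by rintro _ (rfl | rfl) <;> simp) hF2 (.inl rfl) (.inr rfl) hPt hYt hN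

end TypeD

end JGrass

theorem theorem1p1 :
    (∀ (K : Type*) [DivisionRing K] (n : ℕ), 3 ≤ n →
      ∀ (V : Type*) [AddCommGroup V] [Module Kᵐᵒᵖ V] (E : Module.Basis (Fin (n + 1)) Kᵐᵒᵖ V)
        (K₀ : Subfield K), K₀ ≠ ⊤ →
        ¬ JGrass.IsGeneratedOverA n E {1, n} K₀) ∧
    (∀ (K : Type*) [Field K] (n : ℕ), 3 ≤ n →
      ∀ (V : Type*) [AddCommGroup V] [Module K V] (q : QuadraticForm K V)
        (E : Module.Basis (Fin n × Fin 2) K V), JGrass.IsCanonicalExpression q E →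
      ∀ M₀ : Submodule K V, JGrass.IsGenerator n q M₀ →
      ∀ K₀ : Subfield K, K₀ ≠ ⊤ →
        ¬ JGrass.IsGeneratedOverD q E M₀ {.plus, .minus} K₀ ∧
        (4 ≤ n → ¬ JGrass.IsGeneratedOverD q E M₀ {.dim 1, .plus, .minus} K₀) ∧
        (4 ≤ n → ¬ JGrass.IsGeneratedOverD q E M₀ {.dim 1, .minus} K₀)) := by
  refine ⟨fun K _ n hn V _ _ E K₀ hK => JGrass.not_isGeneratedOverA hn E hK, ?_⟩
  intro K _ n hn V _ _ q E hE M₀ hM₀ K₀ hK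
  exact hE.not_isGeneratedOverD hM₀ hn hK
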